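/- All manifolds (and Lie groups) are real, smooth, finite-dimensional, Hausdorff, second countable and without boundary. Let $\pi:P\to M$ be a smooth principal bundle whose structure group is a Lie group $G$ (acting on $P$ from the right) with semisimple Lie algebra $\mathfrak g=\mathrm{Lie}(G)$, i.e. $\mathfrak g$ has no nonzero solvable ideal. Let $\mathcal A=\mathfrak X_G(P)$ be the Lie algebra of $G$-invariant smooth vector fields on $P$ (the smooth sections of the Atiyah algebroid $TP/G$), and let $\mathcal K=\{k\in\mathcal A : T_u\pi(k_u)=0 \text{ for all } u\in P\}$ be the kernel of the Atiyah sequence $0\to\mathcal K\to\mathcal A\xrightarrow{\pi_*}\mathfrak X(M)\to 0$; its elements are the smooth sections of the Lie algebra bundle $K=P\times_G\mathfrak g$. For $u\in P$ and $h\in\mathfrak g$ let $X_u^h\in T_uP$ be the fundamental vector, i.e. the derivative at $1\in G$ of $g\mapsto u\cdot g$ in the direction $h$. Choose for every $m\in M$ a point $\sigma(m)\in P$ with $\pi(\sigma(m))=m$ (no continuity is required) and identify the fibre $K_m$ with $\mathfrak g$ by $[X_{\sigma(m)}^h]\leftrightarrow h$. For $m\in M$ and a Lie ideal $\mathfrak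 g_0$ of $\mathfrak g$ put $$\mathcal K(m,\mathfrak g_0)=\{k\in\mathcal K : k_m\in\mathfrak g_0\}=\{k\in\mathcal K : k_{\sigma(m)}=X_{\sigma(m)}^h\text{ for some }h\in\mathfrak g_0\}.$$ Call a Lie ideal of $\mathcal K$ maximal finite-codimensional if it is maximal among the proper Lie ideals of $\mathcal K$ that have finite codimension. Then, for every choice of $\sigma$, the maximal finite-codimensional Lie ideals of $\mathcal K$ are exactly the subspaces $\mathcal K(m,\mathfrak g_0)$, where $m\in M$ and $\mathfrak g_0$ is a maximal (proper) Lie ideal of $\mathfrak g$. -/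

import Mathlib

open scoped Manifold ContDiff RightActions Topology
open VectorField

namespace Atiyah

noncomputable section

/-- Every `C^∞` manifold (or Lie group) over `ℝ` has the finite smoothness that the Lie bracket
of vector fields asks for. -/
instance leInfty_minSmoothness (n : WithTop ℕ∞) [h : ENat.LEInfty n] :
    ENat.LEInfty (minSmoothness ℝ n) :=
  ⟨by simpa using h.out⟩

section VectorFields

variable {E : Type*} [NormedAddCommGroup E] [NormedSpace ℝ E]
  {H : Type*} [TopologicalSpace H] (I : ModelWithCorners ℝ E H)
  (P : Type*) [TopologicalSpace P] [ChartedSpace H P] [IsManifold I ∞ P]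

/-- The real vector space `𝔛(P)` of smooth vector fields on the manifold `P`. -/
abbrev SmoothVectorField : Type _ :=
  ContMDiffSection I E ∞ (TangentSpace I : P → Type _)

variable {I P}

theorem SmoothVectorField.mdifferentiableAt (X : SmoothVectorField I P) (x : P) :
    MDifferentiableAt I I.tangent (fun y ↦ (X y : TangentBundle I P)) x :=
  (X.contMDiff x).mdifferentiableAt (by simp)

variable [CompleteSpace E]

/-- The Lie bracket of vector fields. -/
instance : Bracket (SmoothVectorField I P) (SmoothVectorField I P) where
  bracket X Y :=
    { toFun := mlieBracket I X Y
      contMDiff_toFun := by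
        have : IsManifold I (((⊤ : ℕ∞) : WithTop ℕ∞) + 1) P := by
          simpa using (inferInstance : IsManifold I ∞ P)
        exact ContDiff.mlieBracket_vectorField (m := ⊤) (n := ⊤) X.contMDiff Y.contMDiff
          (by simp) }

theorem SmoothVectorField.lie_apply (X Y : SmoothVectorField I P) (x : P) :
    ⁅X, Y⁆ x = mlieBracket I X Y x := rfl

theorem SmoothVectorField.coe_lie (X Y : SmoothVectorField I P) :
    (⇑⁅X, Y⁆ : ∀ x, TangentSpace I x) = mlieBracket I X Y := rfl

instance : LieRing (SmoothVectorField I P) where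
  add_lie X Y Z := by
    ext x
    exact mlieBracket_add_left (X.mdifferentiableAt x) (Y.mdifferentiableAt x)
  lie_add X Y Z := by
    ext x
    exact mlieBracket_add_right (Y.mdifferentiableAt x) (Z.mdifferentiableAt x)
  lie_self X := by
    ext x
    simp [SmoothVectorField.lie_apply]
  leibniz_lie X Y Z := by
    ext x
    exact leibniz_identity_mlieBracket_apply
      ((X.contMDiff x).of_le ENat.LEInfty.out) ((Y.contMDiff x).of_le ENat.LEInfty.out)
      ((Z.contMDiff x).of_le ENat.LEInfty.out)

instance : LieAlgebra ℝ (SmoothVectorField I P) where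
  lie_smul c X Y := by
    ext x
    exact mlieBracket_const_smul_right (Y.mdifferentiableAt x)

/-- If a function is constant along two vector fields near a point, it is constant along their
bracket at that point. -/
theorem mvfderiv_lie_eq_zero (X Y : SmoothVectorField I P) (f : P → ℝ) (x : P)
    (hf : ∀ᶠ y in 𝓝 x, ContMDiffAt I 𝓘(ℝ, ℝ) ∞ f y)
    (hX : ∀ᶠ y in 𝓝 x, mfderiv I 𝓘(ℝ, ℝ) f y (X y) = 0)
    (hY : ∀ᶠ y in 𝓝 x, mfderiv I 𝓘(ℝ, ℝ) f y (Y y) = 0) :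
    mfderiv I 𝓘(ℝ, ℝ) f x (⁅X, Y⁆ x) = 0 := by
  have key : ∀ U : SmoothVectorField I P,
      (mvfderiv I f x (⁅X, Y⁆ x)) • U x = 0 := by
    intro U
    have hZ : ∀ Z : SmoothVectorField I P,
        (∀ᶠ y in 𝓝 x, mfderiv I 𝓘(ℝ, ℝ) f y (Z y) = 0) → ∀ W : SmoothVectorField I P,
        mlieBracket I Z (f • (W : ∀ y, TangentSpace I y)) =ᶠ[𝓝 x]
          f • (⇑(⁅Z, W⁆ : SmoothVectorField I P) : ∀ y, TangentSpace I y) := by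
      intro Z hZ W
      filter_upwards [hf, hZ] with y hfy hy
      rw [mlieBracket_smul_right (hfy.mdifferentiableAt (by simp)) (W.mdifferentiableAt y)]
      have : (mvfderiv I f y) (Z y) = 0 := hy
      rw [this, zero_smul, zero_add]
      rfl
    have hfx : ContMDiffAt I 𝓘(ℝ, ℝ) ∞ f x := hf.self_of_nhds
    have hfU : ContMDiffAt I I.tangent (minSmoothness ℝ 2)
        (fun y ↦ ((f • (U : ∀ y, TangentSpace I y)) y : TangentBundle I P)) x :=
      ((hfx.smul_section (U.contMDiff x))).of_le ENat.LEInfty.out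
    have J := leibniz_identity_mlieBracket_apply (I := I)
      ((X.contMDiff x).of_le ENat.LEInfty.out) ((Y.contMDiff x).of_le ENat.LEInfty.out) hfU
    have e1 : mlieBracket I X (mlieBracket I Y (f • (U : ∀ y, TangentSpace I y))) x =
        f x • ⁅X, ⁅Y, U⁆⁆ x := by
      rw [(Filter.EventuallyEq.rfl).mlieBracket_vectorField_eq (hZ Y hY U)]
      exact (hZ X hX ⁅Y, U⁆).self_of_nhds
    have e2 : mlieBracket I Y (mlieBracket I X (f • (U : ∀ y, TangentSpace I y))) x =
        f x • ⁅Y, ⁅X, U⁆⁆ x := by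
      rw [(Filter.EventuallyEq.rfl).mlieBracket_vectorField_eq (hZ X hX U)]
      exact (hZ Y hY ⁅X, U⁆).self_of_nhds
    have e3 : mlieBracket I (mlieBracket I X Y) (f • (U : ∀ y, TangentSpace I y)) x =
        (mvfderiv I f x (⁅X, Y⁆ x)) • U x + f x • ⁅⁅X, Y⁆, U⁆ x :=
      mlieBracket_smul_right (hfx.mdifferentiableAt (by simp)) (U.mdifferentiableAt x)
    have e4 : (⁅X, ⁅Y, U⁆⁆ : SmoothVectorField I P) x
        = ⁅⁅X, Y⁆, U⁆ x + ⁅Y, ⁅X, U⁆⁆ x := by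
      rw [leibniz_lie X Y U]; rfl
    rw [e1, e2, e3, e4, smul_add] at J
    have := add_right_cancel J
    exact (right_eq_add.mp this)
  by_cases h1 : X x = 0
  · by_cases h2 : Y x = 0
    · have : (⁅X, Y⁆ : SmoothVectorField I P) x = 0 := by
        rw [SmoothVectorField.lie_apply, ← mlieBracketWithin_univ]
        exact mlieBracketWithin_eq_zero_of_eq_zero h1 h2
      rw [this, map_zero]
    · exact (smul_eq_zero.mp (key Y)).resolve_right h2
  · exact (smul_eq_zero.mp (key X)).resolve_right h1

end VectorFields

variable {EM : Type*} [NormedAddCommGroup EM] [NormedSpace ℝ EM]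
  {HM : Type*} [TopologicalSpace HM] (IM : ModelWithCorners ℝ EM HM)
  {EG : Type*} [NormedAddCommGroup EG] [NormedSpace ℝ EG]
  {HG : Type*} [TopologicalSpace HG] (IG : ModelWithCorners ℝ EG HG)
  {EP : Type*} [NormedAddCommGroup EP] [NormedSpace ℝ EP]
  {HP : Type*} [TopologicalSpace HP] (IP : ModelWithCorners ℝ EP HP)
  {M : Type*} [TopologicalSpace M] [ChartedSpace HM M]
  {G : Type*} [TopologicalSpace G] [ChartedSpace HG G] [Group G]
  {P : Type*} [TopologicalSpace P] [ChartedSpace HP P] [MulAction Gᵐᵒᵖ P]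

variable (G) in
/-- `π : P → M` is a smooth principal bundle with structure group `G`, for the right action
`(u, g) ↦ u <• g` of `G` on `P`: the action and the projection are smooth, and around every point
of `M` there is a smooth local trivialization `π ⁻¹ U ≃ U × G` over `U` that intertwines the action
with right multiplication on `G`. -/
structure IsPrincipalBundle (π : P → M) : Prop where
  contMDiff_proj : ContMDiff IP IM ∞ π
  contMDiff_act : ContMDiff (IP.prod IG) IP ∞ (fun p : P × G ↦ p.1 <• p.2)
  exists_trivialization : ∀ m : M, ∃ (U : Set M) (e : OpenPartialHomeomorph P (M × G)),
    IsOpen U ∧ m ∈ U ∧ e.source = π ⁻¹' U ∧ e.target = U ×ˢ Set.univ ∧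
    ContMDiffOn IP (IM.prod IG) ∞ e e.source ∧
    ContMDiffOn (IM.prod IG) IP ∞ e.symm e.target ∧
    (∀ u ∈ e.source, (e u).1 = π u) ∧
    ∀ u ∈ e.source, ∀ g : G, u <• g ∈ e.source ∧ e (u <• g) = ((e u).1, (e u).2 * g)

/-- The fundamental vectors `X_u^h`, as a linear map in `h`: the derivative at `1` of the orbit map
`g ↦ u <• g`, from the Lie algebra of `G` to `T_u P`. -/
def fundamentalMap (u : P) :
    GroupLieAlgebra IG G →ₗ[ℝ] TangentSpace IP u where
  toFun h := (mfderiv IG IP (fun g : G ↦ u <• g) 1 h : EP)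
  map_add' h h' := map_add (mfderiv IG IP (fun g : G ↦ u <• g) 1) h h'
  map_smul' c h := map_smul (mfderiv IG IP (fun g : G ↦ u <• g) 1) c h

namespace IsPrincipalBundle

variable {IM IG IP} {π : P → M}

theorem contMDiff_right (hP : IsPrincipalBundle IM IG IP G π)
    (g : G) : ContMDiff IP IP ∞ (fun u : P ↦ u <• g) :=
  hP.contMDiff_act.comp (contMDiff_id.prodMk contMDiff_const)

/-- The diffeomorphism `r_g : u ↦ u <• g` of `P`. -/
def rightDiffeo (hP : IsPrincipalBundle IM IG IP G π) (g : G) :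
    P ≃ₘ^∞⟮IP, IP⟯ P where
  toFun u := u <• g
  invFun u := u <• g⁻¹
  left_inv u := by simp
  right_inv u := by simp
  contMDiff_toFun := hP.contMDiff_right g
  contMDiff_invFun := hP.contMDiff_right g⁻¹

theorem isInvariant_iff (hP : IsPrincipalBundle IM IG IP G π)
    (g : G) (X : ∀ u : P, TangentSpace IP u) :
    (∀ u, mfderiv IP IP (fun v : P ↦ v <• g) u (X u) = X (u <• g)) ↔
      mpullback IP IP (fun v : P ↦ v <• g) X = X := by
  have hinv : ∀ u : P, (mfderiv IP IP (fun v : P ↦ v <• g) u).IsInvertible := fun u ↦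
    ⟨(hP.rightDiffeo g).mfderivToContinuousLinearEquiv (by simp) u, rfl⟩
  constructor
  · intro h
    funext u
    rw [mpullback_apply, ← h u]
    exact (hinv u).inverse_apply_eq.mpr rfl
  · intro h u
    have := congrFun h u
    rw [mpullback_apply] at this
    exact ((hinv u).inverse_apply_eq.mp this).symm

variable [IsManifold IP ∞ P] [CompleteSpace EP]

/-- The Lie algebra `𝒜 = 𝔛_G(P)` of `G`-invariant smooth vector fields on `P`, that is, of smooth
sections of the Atiyah algebroid `TP/G`. -/
def atiyahAlgebra (hP : IsPrincipalBundle IM IG IP G π) :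
    LieSubalgebra ℝ (SmoothVectorField IP P) where
  carrier := {X | ∀ (g : G) (u : P), mfderiv IP IP (fun v : P ↦ v <• g) u (X u) = X (u <• g)}
  add_mem' {X Y} hX hY g u := by
    have := map_add (mfderiv IP IP (fun v : P ↦ v <• g) u) (X u) (Y u)
    rw [hX g u, hY g u] at this
    exact this
  zero_mem' g u := map_zero (mfderiv IP IP (fun v : P ↦ v <• g) u)
  smul_mem' c X hX g u := by
    have := map_smul (mfderiv IP IP (fun v : P ↦ v <• g) u) c (X u)
    rw [hX g u] at this
    exact this
  lie_mem' {X Y} hX hY g := by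
    refine (hP.isInvariant_iff g _).mpr ?_
    funext u
    rw [SmoothVectorField.coe_lie, mpullback_mlieBracket (n := ∞) (X.mdifferentiableAt _)
      (Y.mdifferentiableAt _) (hP.contMDiff_right g u) ENat.LEInfty.out,
      (hP.isInvariant_iff g X).mp (hX g), (hP.isInvariant_iff g Y).mp (hY g)]

variable [IsManifold IM ∞ M]

theorem mfderiv_proj_lie (hP : IsPrincipalBundle IM IG IP G π)
    (X Y : SmoothVectorField IP P)
    (hX : ∀ u, mfderiv IP IM π u (X u) = 0) (hY : ∀ u, mfderiv IP IM π u (Y u) = 0) (u : P) :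
    mfderiv IP IM π u (⁅X, Y⁆ u) = 0 := by
  have hπ : ∀ v, MDifferentiableAt IP IM π v := fun v ↦
    (hP.contMDiff_proj v).mdifferentiableAt (by simp)
  set φ := extChartAt IM (π u) with hφ
  have hsrc : ∀ᶠ v in 𝓝 u, π v ∈ (chartAt HM (π u)).source :=
    hP.contMDiff_proj.continuous.continuousAt.eventually (chart_source_mem_nhds HM (π u))
  have hφs : ∀ y ∈ (chartAt HM (π u)).source, ContMDiffAt IM 𝓘(ℝ, EM) ∞ φ y :=
    fun y hy ↦ contMDiffAt_extChartAt' hy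
  have hd : ∀ (ℓ : EM →L[ℝ] ℝ) (v : P), π v ∈ (chartAt HM (π u)).source →
      ∀ w : TangentSpace IP v, mfderiv IP 𝓘(ℝ, ℝ) (fun v ↦ ℓ (φ (π v))) v w =
        ℓ (mfderiv IM 𝓘(ℝ, EM) φ (π v) (mfderiv IP IM π v w)) := by
    intro ℓ v hv w
    have h1 := (hφs _ hv).mdifferentiableAt (by simp)
    have h2 : HasMFDerivAt IP 𝓘(ℝ, ℝ) (fun v ↦ ℓ (φ (π v))) v _ :=
      (ℓ.hasMFDerivAt (x := φ (π v))).comp v (h1.hasMFDerivAt.comp v (hπ v).hasMFDerivAt)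
    rw [h2.mfderiv]
    rfl
  have hinj : Function.Injective (mfderiv IM 𝓘(ℝ, EM) φ (π u)) :=
    (isInvertible_mfderiv_extChartAt (mem_extChartAt_source (π u))).injective
  apply hinj
  rw [map_zero]
  by_contra hne
  have hsep : ∀ z : EM, z ≠ 0 → ∃ ℓ : EM →L[ℝ] ℝ, ℓ z ≠ 0 := fun z hz ↦
    SeparatingDual.exists_ne_zero hz
  obtain ⟨ℓ, hℓ⟩ := hsep _ hne
  apply hℓ
  have hu : π u ∈ (chartAt HM (π u)).source := mem_chart_source HM (π u)
  refine (hd ℓ u hu _).symm.trans ?_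
  refine mvfderiv_lie_eq_zero X Y _ u ?_ ?_ ?_
  · filter_upwards [hsrc] with v hv
    exact (ℓ.contMDiff.contMDiffAt).comp v ((hφs _ hv).comp v (hP.contMDiff_proj v))
  · filter_upwards [hsrc] with v hv
    rw [hd ℓ v hv, hX v, map_zero]
    exact map_zero ℓ
  · filter_upwards [hsrc] with v hv
    rw [hd ℓ v hv, hY v, map_zero]
    exact map_zero ℓ

/-- The kernel `𝒦` of the Atiyah sequence `0 → 𝒦 → 𝒜 → 𝔛(M) → 0`. The anchor `π_*` sends an
invariant vector field `a` to the vector field on `M` with value `T_u π (a u)` at `π u`, so `𝒦`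
consists of the invariant vector fields `a` with `T_u π (a u) = 0` for all `u`. -/
def atiyahKernel (hP : IsPrincipalBundle IM IG IP G π) :
    LieSubalgebra ℝ hP.atiyahAlgebra where
  carrier := {a | ∀ u : P, mfderiv IP IM π u (a.1 u) = 0}
  add_mem' {a b} ha hb u := by
    have := map_add (mfderiv IP IM π u) (a.1 u) (b.1 u)
    rw [ha u, hb u, add_zero] at this
    exact this
  zero_mem' u := map_zero (mfderiv IP IM π u)
  smul_mem' c a ha u := by
    have := map_smul (mfderiv IP IM π u) c (a.1 u)
    rw [ha u, smul_zero] at this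
    exact this
  lie_mem' {a b} ha hb := hP.mfderiv_proj_lie a.1 b.1 ha hb

/-- The evaluation `k ↦ k u` of elements of `𝒦` at a point `u` of `P`. -/
def evalAt (hP : IsPrincipalBundle IM IG IP G π) (u : P) :
    hP.atiyahKernel →ₗ[ℝ] TangentSpace IP u where
  toFun k := k.1.1 u
  map_add' _ _ := rfl
  map_smul' _ _ := rfl

variable [LieGroup IG ∞ G] [CompleteSpace EG]

/-- The space `𝒦(m, 𝔤₀) = {k ∈ 𝒦 : k_m ∈ 𝔤₀}` for `m = π u`. The fibre at `m` of the bundle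
`K = P ×_G 𝔤` is identified with `𝔤` by means of the point `u` of `P` over `m`, the class of the
fundamental vector `X_u^h` corresponding to `h`; so `k_m ∈ 𝔤₀` means that `k u = X_u^h` for
some `h ∈ 𝔤₀`. -/
def kernelIdeal (hP : IsPrincipalBundle IM IG IP G π) (u : P)
    (g₀ : LieIdeal ℝ (GroupLieAlgebra IG G)) : Submodule ℝ hP.atiyahKernel :=
  (g₀.toSubmodule.map (fundamentalMap IG IP u)).comap (hP.evalAt u)

end IsPrincipalBundle

/-- A maximal finite-codimensional Lie ideal: it is maximal among the proper Lie ideals of finite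
codimension. -/
def IsMaximalFiniteCodimensional {L : Type*} [LieRing L] [LieAlgebra ℝ L]
    (J : LieIdeal ℝ L) : Prop :=
  Maximal (fun J' : LieIdeal ℝ L ↦ J' ≠ ⊤ ∧ FiniteDimensional ℝ (L ⧸ J'.toSubmodule)) J

end

end Atiyah

/-! The kernel `𝒦` is a module over `C^∞(M)` with a `C^∞(M)`-bilinear bracket. Its evaluation at a
point of `P`, read through fundamental vectors and up to sign, is a surjective Lie morphism to `𝔤`
(`evLie`), so preimages of maximal ideals of `𝔤` are maximal of finite codimension. The content is
the converse: a maximal finite-codimensional ideal `J` contains every section that vanishes at a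
certain point `m` (`exists_ker_ev_le`). Then `J` is the preimage of its image in `𝔤`, and that image
is a maximal ideal.

Finitely many sections generate all fibres, even over a noncompact base (`exists_forall_spansAt`).
As `𝔤` is perfect, so is `𝒦`, and this together with maximality makes `J` a `C^∞(M)`-submodule
(`act_mem`). Hence `C^∞(M)` acts on the finite-dimensional space `𝒦/J`, and by maximality each
function acts either as zero or injectively. The functions acting as zero have a common zero `m`
(`exists_forall_apply_eq_zero`). If `f m = 0` and `p` is the minimal polynomial of the action of
`f`, then `p(f)` acts as zero, so `p(0) = 0`; thus `f` is not injective and acts as zero. A section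
vanishing at `m` is a combination of generators with coefficients vanishing at `m`, hence lies in
`J`.

The algebraic argument uses only the properties collected in `IsSectionAlgebra`; the geometric half
verifies them for `𝒦`. -/

namespace Atiyah

noncomputable section

open Set Filter

/-! ### Algebras of sections and their finite generation -/

section Sections

open Module

/-- The values `ev x k` of the elements `k` of the Lie algebra `L` behave like those of the smooth
sections of a bundle of Lie algebras over `M` with all fibres identified with `𝔤`, possibly in a
discontinuous way; `F` is the model fibre. -/
structure IsSectionAlgebra {E : Type*} [NormedAddCommGroup E] [NormedSpace ℝ E]
    {H : Type*} [TopologicalSpace H] (I : ModelWithCorners ℝ E H)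
    (F : Type*) [NormedAddCommGroup F] [NormedSpace ℝ F]
    {M : Type*} [TopologicalSpace M] [ChartedSpace H M]
    {L : Type*} [LieRing L] [LieAlgebra ℝ L] {𝔤 : Type*} [LieRing 𝔤] [LieAlgebra ℝ 𝔤]
    (ev : M → L →ₗ⁅ℝ⁆ 𝔤) : Prop where
  surjective : ∀ x, Function.Surjective (ev x)
  eq_zero : ∀ k, (∀ x, ev x k = 0) → k = 0
  exists_smul : ∀ (f : C^∞⟮I, M; 𝓘(ℝ, ℝ), ℝ⟯) (k : L), ∃ k', ∀ x, ev x k' = f x • ev x k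
  exists_glue : ∀ v : M → 𝔤, (∀ m, ∃ k, ∀ᶠ x in 𝓝 m, ev x k = v x) → ∃ k, ∀ x, ev x k = v x
  exists_coord : ∀ m, ∃ U : Set M, IsOpen U ∧ m ∈ U ∧ ∃ φ : M → 𝔤 ≃ₗ[ℝ] F,
    ∀ k, ∀ x ∈ U, ContMDiffAt I 𝓘(ℝ, F) ∞ (fun y ↦ φ y (ev y k)) x

namespace IsSectionAlgebra

variable {E : Type*} [NormedAddCommGroup E] [NormedSpace ℝ E]
  {H : Type*} [TopologicalSpace H] {I : ModelWithCorners ℝ E H}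
  {F : Type*} [NormedAddCommGroup F] [NormedSpace ℝ F]
  {M : Type*} [TopologicalSpace M] [ChartedSpace H M]
  {L : Type*} [LieRing L] [LieAlgebra ℝ L] {𝔤 : Type*} [LieRing 𝔤] [LieAlgebra ℝ 𝔤]
  {ev : M → L →ₗ⁅ℝ⁆ 𝔤}

theorem ext_of_ev (h : IsSectionAlgebra I F ev) {k k' : L} (hk : ∀ x, ev x k = ev x k') :
    k = k' :=
  sub_eq_zero.mp (h.eq_zero _ fun x ↦ by rw [map_sub, hk x, sub_self])

/-- The family `t` generates the fibre at `x`. -/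
def SpansAt {X : Type*} (ev : X → L →ₗ⁅ℝ⁆ 𝔤) {ι : Type*} (t : ι → L) (x : X) :
    Prop :=
  Submodule.span ℝ (range fun i ↦ ev x (t i)) = ⊤

/-- The map `A x` taking coefficients to a combination of the generators is onto at `m`. With a
fixed right inverse `B` of `A m`, the composite `A x ∘ B` is invertible for `x` near `m`, and `B ∘
(A x ∘ B)⁻¹` is a smooth linear right inverse of `A x`; linearity gives zero coefficients where the
section is zero. -/
theorem exists_local_coeff [FiniteDimensional ℝ F] (h : IsSectionAlgebra I F ev) {ι : Type*}
    [Fintype ι] {t : ι → L} {m : M} (ht : SpansAt ev t m) :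
    ∃ U : Set M, IsOpen U ∧ m ∈ U ∧ ∀ k, ∃ f : M → ι → ℝ,
      ContMDiffOn I 𝓘(ℝ, ι → ℝ) ∞ f U ∧ ∀ x ∈ U, ev x k = ∑ i, f x i • ev x (t i) ∧
        (ev x k = 0 → f x = 0) := by
  obtain ⟨U, hU, hmU, φ, hφ⟩ := h.exists_coord m
  let A : M → ((ι → ℝ) →L[ℝ] F) := fun x ↦
    ∑ i, (ContinuousLinearMap.proj i : (ι → ℝ) →L[ℝ] ℝ).smulRight (φ x (ev x (t i)))
  have hA : ∀ x c, A x c = φ x (∑ i, c i • ev x (t i)) := by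
    intro x c
    simp [A]
  have hAs : ∀ x ∈ U, ContMDiffAt I 𝓘(ℝ, (ι → ℝ) →L[ℝ] F) ∞ A x := by
    intro x hx
    refine ContMDiffAt.sum fun i _ ↦ ?_
    exact ((ContinuousLinearMap.smulRightL ℝ (ι → ℝ) F
      (ContinuousLinearMap.proj i)).contMDiff.contMDiffAt).comp x (hφ (t i) x hx)
  have hsurj : Function.Surjective (A m) := by
    intro w
    have hw : (φ m).symm w ∈ Submodule.span ℝ (range fun i ↦ ev m (t i)) := by
      rw [show Submodule.span ℝ (range fun i ↦ ev m (t i)) = ⊤ from ht]; trivial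
    obtain ⟨c, hc⟩ := (Submodule.mem_span_range_iff_exists_fun ℝ).mp hw
    exact ⟨c, by rw [hA, hc, LinearEquiv.apply_symm_apply]⟩
  obtain ⟨B, hB⟩ := LinearMap.exists_rightInverse_of_surjective (A m : (ι → ℝ) →ₗ[ℝ] F)
    (LinearMap.range_eq_top.mpr hsurj)
  let B' : F →L[ℝ] (ι → ℝ) := LinearMap.toContinuousLinearMap B
  let T : M → (F →L[ℝ] F) := fun x ↦ (A x).comp B'
  have hTs : ∀ x ∈ U, ContMDiffAt I 𝓘(ℝ, F →L[ℝ] F) ∞ T x := fun x hx ↦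
    ((ContinuousLinearMap.compL ℝ F (ι → ℝ) F).flip B').contMDiff.contMDiffAt.comp x (hAs x hx)
  have hTm : T m = 1 := by
    ext w
    exact LinearMap.congr_fun hB w
  have hTc : ContinuousOn T U := fun x hx ↦ (hTs x hx).continuousAt.continuousWithinAt
  refine ⟨U ∩ T ⁻¹' {S | IsUnit S}, hTc.isOpen_inter_preimage hU Units.isOpen, ⟨hmU, ?_⟩, ?_⟩
  · simp [hTm]
  intro k
  refine ⟨fun x ↦ B' (Ring.inverse (T x) (φ x (ev x k))), ?_, ?_⟩
  · rintro x ⟨hx, hu⟩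
    obtain ⟨u, hu⟩ := hu
    have h1 : ContMDiffAt I 𝓘(ℝ, F →L[ℝ] F) ∞ (fun x ↦ Ring.inverse (T x)) x := by
      have := contDiffAt_ringInverse ℝ (n := ∞) u
      rw [hu] at this
      exact this.contMDiffAt.comp x (hTs x hx)
    exact (B'.contMDiff.contMDiffAt.comp x (h1.clm_apply (hφ k x hx))).contMDiffWithinAt
  · rintro x ⟨hx, hu⟩
    refine ⟨?_, fun h0 ↦ by simp [h0]⟩
    apply (φ x).injective
    rw [← hA]
    have : (T x * Ring.inverse (T x)) (φ x (ev x k)) = φ x (ev x k) := by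
      rw [Ring.mul_inverse_cancel _ hu]; rfl
    exact this.symm

theorem eventually_spansAt [FiniteDimensional ℝ F] (h : IsSectionAlgebra I F ev) {ι : Type*}
    [Fintype ι] {t : ι → L} {m : M} (ht : SpansAt ev t m) : ∀ᶠ x in 𝓝 m, SpansAt ev t x := by
  obtain ⟨U, hU, hm, hf⟩ := h.exists_local_coeff ht
  filter_upwards [hU.mem_nhds hm] with x hx
  rw [SpansAt, eq_top_iff]
  intro w _
  obtain ⟨k, rfl⟩ := h.surjective x w
  obtain ⟨f, -, hf⟩ := hf k
  rw [(hf x hx).1]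
  exact Submodule.sum_mem _ fun i _ ↦
    Submodule.smul_mem _ _ (Submodule.subset_span (mem_range_self i))

theorem spansAt_mono {X : Type*} {ev : X → L →ₗ⁅ℝ⁆ 𝔤} {ι κ : Type*} {t : ι → L} {s : κ → L}
    {x : X} (ht : SpansAt ev t x)
    (hts : ∀ i, ev x (t i) ∈ Submodule.span ℝ (range fun j ↦ ev x (s j))) : SpansAt ev s x := by
  rw [SpansAt, eq_top_iff, ← (show Submodule.span ℝ (range fun i ↦ ev x (t i)) = ⊤ from ht),
    Submodule.span_le]
  rintro _ ⟨i, rfl⟩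
  exact hts i

theorem spansAt_of_comp {X : Type*} {ev : X → L →ₗ⁅ℝ⁆ 𝔤} {ι κ : Type*} {t : ι → L} {s : κ → L}
    {x : X} (ht : SpansAt ev t x) (e : ι → κ) (hts : ∀ i, s (e i) = t i) : SpansAt ev s x :=
  spansAt_mono ht fun i ↦ Submodule.subset_span ⟨e i, by simp only [hts]⟩

/-- If finitely many elements generate all fibres, the coefficients of a smooth section can be
chosen smooth, and zero wherever the section is zero. -/
theorem exists_coeff [FiniteDimensional ℝ E] [FiniteDimensional ℝ F] [IsManifold I ∞ M]
    [T2Space M] [SigmaCompactSpace M] (h : IsSectionAlgebra I F ev) {ι : Type*} [Fintype ι]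
    {t : ι → L} (ht : ∀ x, SpansAt ev t x) (k : L) :
    ∃ f : ι → C^∞⟮I, M; 𝓘(ℝ, ℝ), ℝ⟯, ∀ x, ev x k = ∑ i, f i x • ev x (t i) ∧
      (ev x k = 0 → ∀ i, f i x = 0) := by
  -- The admissible coefficient vectors at each point form a convex set, so the local solutions can
  -- be averaged by a partition of unity.
  obtain ⟨g, hg⟩ := exists_contMDiffMap_forall_mem_convex_of_local (I := I) (n := ⊤)
    (t := fun x ↦ {c : ι → ℝ | ev x k = ∑ i, c i • ev x (t i) ∧ (ev x k = 0 → c = 0)})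
    (fun x ↦ by
      rintro c ⟨hc, hc'⟩ d ⟨hd, hd'⟩ a b _ _ hab
      refine ⟨?_, fun h0 ↦ by simp [hc' h0, hd' h0]⟩
      simp only [Pi.add_apply, Pi.smul_apply, add_smul, Finset.sum_add_distrib, smul_assoc,
        ← Finset.smul_sum, ← hc, ← hd]
      rw [← add_smul, hab, one_smul])
    (fun m ↦ by
      obtain ⟨U, hU, hm, hf⟩ := h.exists_local_coeff (ht m)
      obtain ⟨f, hf, hf'⟩ := hf k
      exact ⟨U, hU.mem_nhds hm, f, hf, hf'⟩)
  refine ⟨fun i ↦ ⟨fun x ↦ g x i, ?_⟩, fun x ↦ ⟨(hg x).1, fun h0 i ↦ congrFun ((hg x).2 h0) i⟩⟩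
  exact contMDiff_pi_space.mp g.contMDiff i

theorem exists_spansAt [FiniteDimensional ℝ 𝔤] (h : IsSectionAlgebra I F ev) (m : M) :
    ∃ (n : ℕ) (t : Fin n → L), SpansAt ev t m := by
  let b := finBasis ℝ 𝔤
  choose t ht using fun i ↦ h.surjective m (b i)
  refine ⟨_, t, ?_⟩
  simp only [SpansAt, ht]
  exact b.span_eq

theorem exists_spansAt_of_isCompact [FiniteDimensional ℝ F] [FiniteDimensional ℝ 𝔤]
    (h : IsSectionAlgebra I F ev) {A : Set M} (hA : IsCompact A) :
    ∃ (n : ℕ) (t : Fin n → L), ∀ x ∈ A, SpansAt ev t x := by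
  refine hA.induction_on ?_ ?_ ?_ ?_
  · exact ⟨0, Fin.elim0, by simp⟩
  · rintro s s' hs ⟨n, t, ht⟩
    exact ⟨n, t, fun x hx ↦ ht x (hs hx)⟩
  · rintro s s' ⟨n, t, ht⟩ ⟨n', t', ht'⟩
    refine ⟨n + n', Fin.append t t', ?_⟩
    rintro x (hx | hx)
    · exact spansAt_of_comp (ht x hx) (Fin.castAdd n') (by simp)
    · exact spansAt_of_comp (ht' x hx) (Fin.natAdd n) (by simp)
  · intro m _
    obtain ⟨n, t, ht⟩ := h.exists_spansAt m
    exact ⟨_, mem_nhdsWithin_of_mem_nhds (h.eventually_spansAt ht), n, t, fun _ hx ↦ hx⟩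

/-- A smooth function that dominates the index of the first member of a compact exhaustion
containing the point. It replaces compactness of `M`, both for finite generation and for finding the
common zero. -/
theorem exists_exhaustion [FiniteDimensional ℝ E] [IsManifold I ∞ M] [T2Space M]
    [SigmaCompactSpace M] [WeaklyLocallyCompactSpace M] :
    ∃ ρ : C^∞⟮I, M; 𝓘(ℝ, ℝ), ℝ⟯, ∀ c : ℝ, IsCompact (ρ ⁻¹' Iic c) := by
  let K := CompactExhaustion.choice M
  obtain ⟨ρ, hρ⟩ := exists_contMDiffMap_forall_mem_convex_of_local_const (I := I) (n := ⊤)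
    (t := fun x ↦ Ici (K.find x : ℝ)) (fun x ↦ convex_Ici _) (fun m ↦ by
      refine ⟨(K.find m + 1 : ℕ), ?_⟩
      filter_upwards [isOpen_interior.mem_nhds (K.subset_interior_succ _ (K.mem_find m))] with y hy
      exact mem_Ici.mpr (Nat.cast_le.mpr (K.mem_iff_find_le.mp (interior_subset hy))))
  refine ⟨ρ, fun c ↦ (K.isCompact ⌈c⌉₊).of_isClosed_subset
    (isClosed_Iic.preimage ρ.contMDiff.continuous) fun x hx ↦ K.mem_iff_find_le.mpr ?_⟩
  have h1 : (K.find x : ℝ) ≤ c := (hρ x).trans hx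
  exact_mod_cast h1.trans (Nat.le_ceil c)

/-- The parameters `a` for which the elements `t i + a i • s` fail to generate a fibre near `m`
form a set of small dimension. -/
theorem exists_dimH_le [FiniteDimensional ℝ E] [FiniteDimensional ℝ F] [I.Boundaryless]
    [IsManifold I ∞ M] (h : IsSectionAlgebra I F ev) {n : ℕ} (t : Fin n → L) (s : L) (m : M) :
    ∃ V ∈ 𝓝 m, ∃ B : Set (Fin n → ℝ), dimH B ≤ (finrank ℝ E + finrank ℝ F : ℕ) ∧
      ∀ a ∉ B, ∀ x ∈ V, SpansAt ev (Fin.cons s t : Fin (n + 1) → L) x →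
        SpansAt ev (fun i ↦ t i + a i • s) x := by
  obtain ⟨U, hU, hmU, φ, hφ⟩ := h.exists_coord m
  let ψ := extChartAt I m
  have hO : IsOpen (ψ.target ∩ ψ.symm ⁻¹' U) :=
    (continuousOn_extChartAt_symm m).isOpen_inter_preimage (isOpen_extChartAt_target m) hU
  have hmO : ψ m ∈ ψ.target ∩ ψ.symm ⁻¹' U :=
    ⟨mem_extChartAt_target m, by simpa [ψ] using hmU⟩
  obtain ⟨ε, hε, hball⟩ := Metric.isOpen_iff.mp hO _ hmO
  -- A bad parameter `a` at `x` comes with a nonzero functional `ξ` such that `ξ(t i) + a i * ξ(s) =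
  -- 0` for all `i`. Normalized to `ξ(s) = 1`, this reads `a i = -ξ(t i)`, so bad parameters lie in
  -- the image of a `C^1` map on a set of dimension `dim E + dim F`.
  let Φ : E × (F →L[ℝ] ℝ) → (Fin n → ℝ) := fun p i ↦
    -(p.2 (φ (ψ.symm p.1) (ev (ψ.symm p.1) (t i))))
  let D : Set (E × (F →L[ℝ] ℝ)) := Metric.ball (ψ m) ε ×ˢ univ
  have hsm : ∀ k, ContDiffOn ℝ 1 (fun y ↦ φ (ψ.symm y) (ev (ψ.symm y) k))
      (Metric.ball (ψ m) ε) := by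
    intro k y hy
    have hy' := hball hy
    have h1 : ContMDiffAt 𝓘(ℝ, E) I ∞ ψ.symm y :=
      (contMDiffOn_extChartAt_symm m).contMDiffAt
        ((isOpen_extChartAt_target m).mem_nhds hy'.1)
    have h2 := (hφ k (ψ.symm y) hy'.2).comp y h1
    exact (h2.contDiffAt.of_le (by simp)).contDiffWithinAt
  have hΦ : ContDiffOn ℝ 1 Φ D := by
    refine contDiffOn_pi.mpr fun i ↦ ContDiffOn.neg ?_
    refine ContDiffOn.clm_apply contDiff_snd.contDiffOn ?_
    exact (hsm (t i)).comp contDiff_fst.contDiffOn fun p hp ↦ hp.1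
  refine ⟨ψ.source ∩ ψ ⁻¹' Metric.ball (ψ m) ε, ?_, Φ '' D, ?_, ?_⟩
  · exact inter_mem (extChartAt_source_mem_nhds m)
      ((continuousAt_extChartAt m).preimage_mem_nhds (Metric.ball_mem_nhds _ hε))
  · calc dimH (Φ '' D) ≤ dimH D :=
          hΦ.dimH_image_le ((convex_ball _ _).prod convex_univ) Subset.rfl
      _ ≤ dimH (univ : Set (E × (F →L[ℝ] ℝ))) := dimH_mono (subset_univ _)
      _ = finrank ℝ (E × (F →L[ℝ] ℝ)) := Real.dimH_univ_eq_finrank _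
      _ = (finrank ℝ E + finrank ℝ F : ℕ) := by
          rw [finrank_prod, ← (LinearMap.toContinuousLinearMap (𝕜 := ℝ) (E := F)
            (F' := ℝ)).finrank_eq, Subspace.dual_finrank_eq]
  · rintro a ha x ⟨hx, hxb⟩ hs
    by_contra hns
    apply ha
    let W := (Submodule.span ℝ (range fun i ↦ ev x (t i + a i • s))).map
      (φ x : 𝔤 →ₗ[ℝ] F)
    have hW : W < ⊤ := by
      refine lt_top_iff_ne_top.mpr fun hW ↦ hns ?_
      rw [SpansAt, eq_top_iff]
      intro w _
      have hw : φ x w ∈ W := by rw [hW]; trivial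
      obtain ⟨w', hw', hww⟩ := hw
      rwa [← (φ x).injective hww]
    obtain ⟨ξ, hξ0, hξ⟩ := W.exists_le_ker_of_lt_top hW
    have hti : ∀ i, ξ (φ x (ev x (t i))) + a i * ξ (φ x (ev x s)) = 0 := by
      intro i
      have : φ x (ev x (t i + a i • s)) ∈ W :=
        ⟨_, Submodule.subset_span (mem_range_self i), rfl⟩
      simpa using hξ this
    -- If `ξ` killed `s` it would kill every `t i` too, although `s` and the `t i` together span the
    -- fibre.
    have hs0 : ξ (φ x (ev x s)) ≠ 0 := by
      intro h0
      apply hξ0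
      have : Submodule.span ℝ (range fun i ↦ ev x ((Fin.cons s t : Fin (n + 1) → L) i)) ≤
          LinearMap.ker (ξ ∘ₗ (φ x : 𝔤 →ₗ[ℝ] F)) := by
        rw [Submodule.span_le]
        rintro _ ⟨i, rfl⟩
        refine Fin.cases ?_ (fun i ↦ ?_) i
        · simpa using h0
        · simpa [h0] using hti i
      rw [show Submodule.span ℝ _ = ⊤ from hs, top_le_iff, LinearMap.ker_eq_top] at this
      ext w
      simpa using LinearMap.congr_fun this ((φ x).symm w)
    refine ⟨(ψ x, (ξ (φ x (ev x s)))⁻¹ • LinearMap.toContinuousLinearMap ξ), ⟨hxb, trivial⟩, ?_⟩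
    funext i
    have hψx : ψ.symm (ψ x) = x := ψ.left_inv hx
    simp only [Φ, hψx]
    have := hti i
    simp only [smul_apply, LinearMap.coe_toContinuousLinearMap', smul_eq_mul]
    field_simp
    linarith

/-- General position: one generator can be absorbed into the others, because the bad parameters in
`ℝ^n` have Hausdorff dimension less than `n` and so miss some point. -/
theorem exists_spansAt_pred [FiniteDimensional ℝ E] [FiniteDimensional ℝ F] [I.Boundaryless]
    [IsManifold I ∞ M] (h : IsSectionAlgebra I F ev) {A : Set M} (hA : IsCompact A) {n : ℕ}
    (hn : finrank ℝ E + finrank ℝ F < n) {t : Fin (n + 1) → L} (ht : ∀ x ∈ A, SpansAt ev t x) :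
    ∃ t' : Fin n → L, ∀ x ∈ A, SpansAt ev t' x := by
  have key : ∃ B : Set (Fin n → ℝ), dimH B ≤ (finrank ℝ E + finrank ℝ F : ℕ) ∧
      ∀ a ∉ B, ∀ x ∈ A, SpansAt ev t x →
        SpansAt ev (fun i : Fin n ↦ t i.succ + a i • t 0) x := by
    refine hA.induction_on ?_ ?_ ?_ ?_
    · exact ⟨∅, by simp, by simp⟩
    · rintro s s' hs ⟨B, hB, hB'⟩
      exact ⟨B, hB, fun a ha x hx ↦ hB' a ha x (hs hx)⟩
    · rintro s s' ⟨B, hB, hB'⟩ ⟨C, hC, hC'⟩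
      refine ⟨B ∪ C, by rw [dimH_union]; exact max_le hB hC, fun a ha x hx ↦ ?_⟩
      rcases hx with hx | hx
      · exact hB' a (fun h ↦ ha (Or.inl h)) x hx
      · exact hC' a (fun h ↦ ha (Or.inr h)) x hx
    · intro m _
      obtain ⟨V, hV, B, hB, hB'⟩ := h.exists_dimH_le (fun i : Fin n ↦ t i.succ) (t 0) m
      refine ⟨V, mem_nhdsWithin_of_mem_nhds hV, B, hB, fun a ha x hx hs ↦ hB' a ha x hx ?_⟩
      rwa [show (Fin.cons (t 0) fun i : Fin n ↦ t i.succ : Fin (n + 1) → L) = t from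
        Fin.cons_self_tail t]
  obtain ⟨B, hB, hB'⟩ := key
  have hd : Dense Bᶜ := by
    refine dense_compl_of_dimH_lt_finrank (hB.trans_lt ?_)
    rw [finrank_fin_fun]
    exact_mod_cast hn
  obtain ⟨a, ha⟩ := hd.nonempty
  exact ⟨_, fun x hx ↦ hB' a ha x hx (ht x hx)⟩

/-- Over a compact set, a number of generators that depends only on the dimensions suffices. -/
theorem exists_spansAt_finrank [FiniteDimensional ℝ E] [FiniteDimensional ℝ F]
    [FiniteDimensional ℝ 𝔤] [I.Boundaryless] [IsManifold I ∞ M] (h : IsSectionAlgebra I F ev)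
    {A : Set M} (hA : IsCompact A) :
    ∃ t : Fin (finrank ℝ E + finrank ℝ F + 1) → L, ∀ x ∈ A, SpansAt ev t x := by
  obtain ⟨n, t, ht⟩ := h.exists_spansAt_of_isCompact hA
  set N := finrank ℝ E + finrank ℝ F + 1 with hN
  have hdown : ∀ j (t : Fin (N + j) → L), (∀ x ∈ A, SpansAt ev t x) →
      ∃ t' : Fin N → L, ∀ x ∈ A, SpansAt ev t' x := by
    intro j
    induction j with
    | zero => exact fun t ht ↦ ⟨t, ht⟩
    | succ j ih =>
      intro t ht
      obtain ⟨t', ht'⟩ := h.exists_spansAt_pred hA (n := N + j) (by omega) ht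
      exact ih t' ht'
  -- Padding with `N` zeros gives the family a length of the form `N + n`, whether or not `n`
  -- exceeds `N`.
  refine hdown n (Fin.append (0 : Fin N → L) t) fun x hx ↦ ?_
  exact spansAt_of_comp (ht x hx) (Fin.natAdd N) (by simp)

/-- Finitely many elements generate all fibres. -/
theorem exists_forall_spansAt [FiniteDimensional ℝ E] [FiniteDimensional ℝ F]
    [FiniteDimensional ℝ 𝔤] [I.Boundaryless] [IsManifold I ∞ M] [T2Space M]
    [SigmaCompactSpace M] [WeaklyLocallyCompactSpace M] (h : IsSectionAlgebra I F ev) :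
    ∃ (ι : Type) (_ : Fintype ι) (t : ι → L), ∀ x, SpansAt ev t x := by
  obtain ⟨ρ, hρ⟩ := exists_exhaustion (I := I) (M := M)
  -- The size of the generating family does not depend on `n`; hence the families for different
  -- bands of `ρ` can be glued index by index into finitely many sections.
  choose t ht using fun n : ℤ ↦ h.exists_spansAt_finrank (hρ (n + 1))
  let b : ContDiffBump (0 : ℝ) := ⟨1 / 2, 4 / 5, by norm_num, by norm_num⟩
  have hb0 : ∀ y : ℝ, 4 / 5 ≤ |y| → b y = 0 := fun y hy ↦
    b.zero_of_le_dist (by simpa [Real.dist_eq] using hy)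
  have hb1 : ∀ y : ℝ, |y| ≤ 1 / 2 → b y = 1 := fun y hy ↦
    b.one_of_mem_closedBall (by rwa [Metric.mem_closedBall, Real.dist_eq, sub_zero])
  let χ : ℝ → C^∞⟮I, M; 𝓘(ℝ, ℝ), ℝ⟯ := fun c ↦
    ⟨fun x ↦ b (ρ x - c), (b.contDiff.contMDiff).comp (ρ.contMDiff.sub contMDiff_const)⟩
  -- A nearest integer to `y` of parity `ε`. Bumps centred at integers of the same parity have
  -- disjoint supports, since the radius `4/5` is less than `1`; bumps of both parities together
  -- cover the line, since they equal `1` up to distance `1/2`.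
  let r : Fin 2 → ℝ → ℤ := fun ε y ↦ 2 * round ((y - (ε : ℕ)) / 2) + (ε : ℕ)
  have hr : ∀ ε y, |y - r ε y| ≤ 1 := by
    intro ε y
    have := abs_le.mp (abs_sub_round ((y - (ε : ℕ)) / 2))
    simp only [r]
    push_cast
    rw [abs_le]
    constructor <;> linarith [this.1, this.2]
  have hr2 : ∀ ε y y', r ε y ≠ r ε y' → (2 : ℝ) ≤ |(r ε y : ℝ) - r ε y'| := by
    intro ε y y' hne
    have : (2 : ℤ) ≤ |r ε y - r ε y'| := by
      simp only [r] at hne ⊢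
      rw [le_abs]
      omega
    exact_mod_cast this
  have hglue : ∀ p : Fin 2 × Fin (finrank ℝ E + finrank ℝ F + 1), ∃ k, ∀ x,
      ev x k = b (ρ x - r p.1 (ρ x)) • ev x (t (r p.1 (ρ x)) p.2) := by
    rintro ⟨ε, i⟩
    refine h.exists_glue _ fun m ↦ ?_
    obtain ⟨k, hk⟩ := h.exists_smul (χ (r ε (ρ m))) (t (r ε (ρ m)) i)
    refine ⟨k, ?_⟩
    have hnear : ∀ᶠ x in 𝓝 m, |ρ x - ρ m| < 1 / 10 := by
      have : ContinuousAt (fun x ↦ |ρ x - ρ m|) m :=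
        ((ρ.contMDiff.continuous.sub continuous_const).abs).continuousAt
      exact this.eventually_lt continuousAt_const (by simp)
    filter_upwards [hnear] with x hx
    rw [hk x]
    change b (ρ x - r ε (ρ m)) • _ = _
    by_cases hrr : r ε (ρ x) = r ε (ρ m)
    · rw [hrr]
    -- If the nearest integer jumps between `m` and `x`, then `ρ x` has distance at least `1` from
    -- the old centre and at least `2 - 1 - 1/10` from the new one. Both exceed `4/5`, so both bumps
    -- vanish.
    · have h1 := abs_le.mp (hr ε (ρ x))
      have h2 := abs_le.mp (hr ε (ρ m))
      have h3 := abs_lt.mp hx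
      have h4 := le_abs.mp (hr2 ε _ _ hrr)
      rw [hb0 _ (by rw [le_abs]; rcases h4 with h4 | h4
                    · left; linarith
                    · right; linarith),
        hb0 _ (by rw [le_abs]; rcases h4 with h4 | h4
                  · right; linarith
                  · left; linarith), zero_smul, zero_smul]
  choose T hT using hglue
  refine ⟨_, inferInstance, T, fun x ↦ ?_⟩
  -- For the parity of the integer nearest to `ρ x`, the bump is `1` at `x`, so the glued sections
  -- restrict to generators there.
  obtain ⟨ε, hε⟩ : ∃ ε : Fin 2, r ε (ρ x) = round (ρ x) := by
    have hn := abs_le.mp (abs_sub_round (ρ x))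
    obtain ⟨j, hj | hj⟩ := Int.even_or_odd' (round (ρ x))
    · refine ⟨0, ?_⟩
      have : round ((ρ x - ((0 : Fin 2) : ℕ)) / 2) = j := by
        rw [round_eq, Int.floor_eq_iff]
        rw [hj] at hn
        push_cast at hn ⊢
        simp only [Fin.val_zero, Nat.cast_zero]
        constructor <;> linarith [hn.1, hn.2]
      simp only [r, this, hj]
      simp
    · refine ⟨1, ?_⟩
      have : round ((ρ x - ((1 : Fin 2) : ℕ)) / 2) = j := by
        rw [round_eq, Int.floor_eq_iff]
        rw [hj] at hn
        push_cast at hn ⊢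
        simp only [Fin.val_one, Nat.cast_one]
        constructor <;> linarith [hn.1, hn.2]
      simp only [r, this, hj]
      simp
  have hx : SpansAt ev (t (round (ρ x))) x := by
    refine ht _ x ?_
    have := (abs_le.mp (abs_sub_round (ρ x))).2
    simp only [mem_preimage, mem_Iic]
    linarith
  refine spansAt_mono hx fun i ↦ Submodule.subset_span ⟨(ε, i), ?_⟩
  simp only [hT, hε]
  rw [hb1 _ (abs_sub_round _), one_smul]

end IsSectionAlgebra

/-- An ideal complementary to `[𝔤, 𝔤]` is abelian, because its brackets lie in both; so it is zero
by semisimplicity. -/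
theorem span_lie_eq_top (𝔤 : Type*) [LieRing 𝔤] [LieAlgebra ℝ 𝔤] [FiniteDimensional ℝ 𝔤]
    [LieAlgebra.HasTrivialRadical ℝ 𝔤] :
    Submodule.span ℝ {z : 𝔤 | ∃ x y : 𝔤, ⁅x, y⁆ = z} = ⊤ := by
  have hD : ⁅(⊤ : LieIdeal ℝ 𝔤), (⊤ : LieIdeal ℝ 𝔤)⁆ = ⊤ := by
    obtain ⟨C, hC⟩ := exists_isCompl ⁅(⊤ : LieIdeal ℝ 𝔤), (⊤ : LieIdeal ℝ 𝔤)⁆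
    have hab : IsLieAbelian C := by
      refine ⟨fun x y ↦ Subtype.ext ?_⟩
      have h1 : ⁅(x : 𝔤), (y : 𝔤)⁆ ∈ ⁅(⊤ : LieIdeal ℝ 𝔤), (⊤ : LieIdeal ℝ 𝔤)⁆ :=
        LieSubmodule.lie_mem_lie (LieSubmodule.mem_top _) (LieSubmodule.mem_top _)
      have h2 : ⁅(x : 𝔤), (y : 𝔤)⁆ ∈ C := C.lie_mem y.2
      have h3 : ⁅(x : 𝔤), (y : 𝔤)⁆ ∈ ⁅(⊤ : LieIdeal ℝ 𝔤), (⊤ : LieIdeal ℝ 𝔤)⁆ ⊓ C := ⟨h1, h2⟩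
      rw [hC.inf_eq_bot] at h3
      exact h3
    have hC0 : C = ⊥ := (LieAlgebra.hasTrivialRadical_iff_no_abelian_ideals ℝ 𝔤).mp
      inferInstance C hab
    have := hC.sup_eq_top
    rwa [hC0, sup_bot_eq] at this
  have := LieSubmodule.lieIdeal_oper_eq_linear_span' (I := (⊤ : LieIdeal ℝ 𝔤))
    (N := (⊤ : LieIdeal ℝ 𝔤))
  rw [hD, LieSubmodule.top_toSubmodule] at this
  rw [this]
  congr 1
  ext z
  simp

/-! ### Maximal finite-codimensional ideals and surjective morphisms -/

section MaximalIdeals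

variable {L : Type*} [LieRing L] [LieAlgebra ℝ L]

/-- Ideals above one of finite codimension have finite codimension themselves, so `J` is maximal
among all proper ideals. -/
theorem IsMaximalFiniteCodimensional.eq_or_eq_top {J : LieIdeal ℝ L}
    (hJ : IsMaximalFiniteCodimensional J) {N : LieIdeal ℝ L} (hN : J ≤ N) : N = J ∨ N = ⊤ := by
  by_cases h : N = ⊤
  · exact Or.inr h
  · left
    have hfin := hJ.prop.2
    refine le_antisymm (hJ.le_of_ge ⟨h, ?_⟩ hN) hN
    exact Module.Finite.of_surjective (Submodule.factor (p := J.toSubmodule)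
      (p' := N.toSubmodule) hN) (Submodule.factor_surjective _)

variable {𝔤 : Type*} [LieRing 𝔤] [LieAlgebra ℝ 𝔤] {f : L →ₗ⁅ℝ⁆ 𝔤}

theorem map_comap_of_surjective (hf : Function.Surjective f) (g₀ : LieIdeal ℝ 𝔤) :
    LieIdeal.map f (LieIdeal.comap f g₀) = g₀ := by
  refine le_antisymm LieIdeal.map_comap_le fun y hy ↦ ?_
  obtain ⟨x, rfl⟩ := hf y
  exact LieIdeal.mem_map hy

theorem comap_map_of_surjective (hf : Function.Surjective f) {J : LieIdeal ℝ L}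
    (hJ : ∀ k, f k = 0 → k ∈ J) : LieIdeal.comap f (LieIdeal.map f J) = J := by
  refine le_antisymm (fun x hx ↦ ?_) LieIdeal.comap_map_le
  obtain ⟨⟨y, hy⟩, hxy⟩ := LieIdeal.mem_map_of_surjective hf hx
  have : x - y ∈ J := hJ _ (by rw [map_sub]; exact sub_eq_zero.mpr hxy.symm)
  simpa using add_mem this hy

theorem isMaximalFiniteCodimensional_comap [FiniteDimensional ℝ 𝔤] (hf : Function.Surjective f)
    {g₀ : LieIdeal ℝ 𝔤} (hg : IsCoatom g₀) : IsMaximalFiniteCodimensional (LieIdeal.comap f g₀) := by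
  refine ⟨⟨fun h ↦ hg.1 ?_, ?_⟩, ?_⟩
  · rw [← map_comap_of_surjective hf g₀, h, eq_top_iff]
    intro y _
    obtain ⟨x, rfl⟩ := hf y
    exact LieIdeal.mem_map (LieSubmodule.mem_top x)
  · refine Module.Finite.of_injective ((LieIdeal.comap f g₀).toSubmodule.mapQ g₀.toSubmodule
      (f : L →ₗ[ℝ] 𝔤) (LieIdeal.comap_toSubmodule ..).le) ?_
    rw [injective_iff_map_eq_zero]
    intro x
    induction x using Submodule.Quotient.induction_on with
    | H x =>
      intro hx
      have : f x ∈ g₀.toSubmodule := (Submodule.Quotient.mk_eq_zero _).mp hx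
      exact (Submodule.Quotient.mk_eq_zero _).mpr this
  · rintro J ⟨hJ, -⟩ hle
    have hker : ∀ k, f k = 0 → k ∈ J := fun k hk ↦ hle (by
      rw [LieIdeal.mem_comap, hk]; exact zero_mem _)
    have h1 : g₀ ≤ LieIdeal.map f J := by
      rw [← map_comap_of_surjective hf g₀]
      exact LieIdeal.map_mono hle
    rcases eq_or_lt_of_le h1 with h | h
    · rw [h]; exact LieIdeal.comap_map_le
    · refine absurd ?_ hJ
      rw [← comap_map_of_surjective hf hker, hg.2 _ h, eq_top_iff]
      intro x _
      exact LieSubmodule.mem_top (R := ℝ) (L := 𝔤) (f x)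

theorem isCoatom_map (hf : Function.Surjective f) {J : LieIdeal ℝ L}
    (hJ : IsMaximalFiniteCodimensional J) (hker : ∀ k, f k = 0 → k ∈ J) :
    IsCoatom (LieIdeal.map f J) := by
  refine ⟨fun h ↦ hJ.prop.1 ?_, fun b hb ↦ ?_⟩
  · rw [← comap_map_of_surjective hf hker, h, eq_top_iff]
    intro x _
    exact LieSubmodule.mem_top (R := ℝ) (L := 𝔤) (f x)
  · have h1 : J ≤ LieIdeal.comap f b := LieIdeal.map_le_iff_le_comap.mp hb.le
    rcases hJ.eq_or_eq_top h1 with h | h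
    · refine absurd ?_ hb.not_ge
      rw [← map_comap_of_surjective hf b, h]
    · rw [eq_top_iff]
      intro y _
      obtain ⟨x, rfl⟩ := hf y
      have : x ∈ LieIdeal.comap f b := by rw [h]; exact LieSubmodule.mem_top x
      exact this

end MaximalIdeals

/-! ### Maximal finite-codimensional ideals of an algebra of sections -/

namespace IsSectionAlgebra

variable {E : Type*} [NormedAddCommGroup E] [NormedSpace ℝ E]
  {H : Type*} [TopologicalSpace H] {I : ModelWithCorners ℝ E H}
  {F : Type*} [NormedAddCommGroup F] [NormedSpace ℝ F]
  {M : Type*} [TopologicalSpace M] [ChartedSpace H M]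
  {L : Type*} [LieRing L] [LieAlgebra ℝ L] {𝔤 : Type*} [LieRing 𝔤] [LieAlgebra ℝ 𝔤]
  {ev : M → L →ₗ⁅ℝ⁆ 𝔤}

theorem aeval_apply (p : Polynomial ℝ) (f : C^∞⟮I, M; 𝓘(ℝ, ℝ), ℝ⟯) (x : M) :
    (Polynomial.aeval f p) x = p.eval (f x) := by
  induction p using Polynomial.induction_on' with
  | add p q hp hq => simp [hp, hq]
  | monomial n a =>
    rw [Polynomial.aeval_monomial, Polynomial.eval_monomial]
    exact congrArg₂ (· * ·) rfl (map_pow (ContMDiffMap.evalRingHom x) f n)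

/-- The action of smooth functions on sections. -/
def act (h : IsSectionAlgebra I F ev) : C^∞⟮I, M; 𝓘(ℝ, ℝ), ℝ⟯ →ₐ[ℝ] Module.End ℝ L :=
  AlgHom.ofLinearMap
    { toFun := fun f ↦
        { toFun := fun k ↦ (h.exists_smul f k).choose
          map_add' := fun k k' ↦ h.ext_of_ev fun x ↦ by
            rw [map_add, (h.exists_smul f _).choose_spec, (h.exists_smul f _).choose_spec,
              (h.exists_smul f _).choose_spec, map_add, smul_add]
          map_smul' := fun c k ↦ h.ext_of_ev fun x ↦ by
            rw [map_smul, (h.exists_smul f _).choose_spec, (h.exists_smul f _).choose_spec,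
              map_smul, smul_comm, RingHom.id_apply] }
      map_add' := fun f g ↦ LinearMap.ext fun k ↦ h.ext_of_ev fun x ↦ by
        rw [LinearMap.add_apply, map_add]
        simp only [LinearMap.coe_mk, AddHom.coe_mk, (h.exists_smul _ _).choose_spec x]
        exact add_smul _ _ _
      map_smul' := fun c f ↦ LinearMap.ext fun k ↦ h.ext_of_ev fun x ↦ by
        rw [LinearMap.smul_apply, map_smul]
        simp only [LinearMap.coe_mk, AddHom.coe_mk, (h.exists_smul _ _).choose_spec x]
        exact smul_assoc c (f x) _ }
    (LinearMap.ext fun k ↦ h.ext_of_ev fun x ↦ by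
      simp only [LinearMap.coe_mk, AddHom.coe_mk, (h.exists_smul _ _).choose_spec x]
      exact one_smul _ _)
    (fun f g ↦ LinearMap.ext fun k ↦ h.ext_of_ev fun x ↦ by
      rw [Module.End.mul_apply]
      simp only [LinearMap.coe_mk, AddHom.coe_mk, (h.exists_smul _ _).choose_spec x]
      exact mul_smul _ _ _)

theorem ev_act (h : IsSectionAlgebra I F ev) (f : C^∞⟮I, M; 𝓘(ℝ, ℝ), ℝ⟯) (k : L) (x : M) :
    ev x (h.act f k) = f x • ev x k :=
  (h.exists_smul f k).choose_spec x

theorem act_lie (h : IsSectionAlgebra I F ev) (f : C^∞⟮I, M; 𝓘(ℝ, ℝ), ℝ⟯) (k k' : L) :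
    ⁅h.act f k, k'⁆ = h.act f ⁅k, k'⁆ :=
  h.ext_of_ev fun x ↦ by rw [LieHom.map_lie, h.ev_act, h.ev_act, LieHom.map_lie, smul_lie]

theorem lie_act (h : IsSectionAlgebra I F ev) (f : C^∞⟮I, M; 𝓘(ℝ, ℝ), ℝ⟯) (k k' : L) :
    ⁅k, h.act f k'⁆ = h.act f ⁅k, k'⁆ :=
  h.ext_of_ev fun x ↦ by rw [LieHom.map_lie, h.ev_act, h.ev_act, LieHom.map_lie, lie_smul]

theorem exists_eq_sum_act [FiniteDimensional ℝ E] [FiniteDimensional ℝ F] [IsManifold I ∞ M]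
    [T2Space M] [SigmaCompactSpace M] (h : IsSectionAlgebra I F ev)
    {ι : Type*} [Fintype ι] {t : ι → L} (ht : ∀ x, SpansAt ev t x) (k : L) :
    ∃ f : ι → C^∞⟮I, M; 𝓘(ℝ, ℝ), ℝ⟯, k = ∑ i, h.act (f i) (t i) ∧
      ∀ x, ev x k = 0 → ∀ i, f i x = 0 := by
  obtain ⟨f, hf⟩ := h.exists_coeff ht k
  refine ⟨f, h.ext_of_ev fun x ↦ ?_, fun x ↦ (hf x).2⟩
  rw [map_sum, (hf x).1]
  simp only [h.ev_act]

variable [FiniteDimensional ℝ E] [FiniteDimensional ℝ F] [FiniteDimensional ℝ 𝔤] [I.Boundaryless]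
  [IsManifold I ∞ M] [T2Space M] [SigmaCompactSpace M] [WeaklyLocallyCompactSpace M]

/-- Brackets of generators generate all fibres, since `𝔤` is perfect; a coefficient function in
front of a bracket can be moved into its first entry. -/
theorem span_lie_eq_top [LieAlgebra.HasTrivialRadical ℝ 𝔤] (h : IsSectionAlgebra I F ev) :
    Submodule.span ℝ {z : L | ∃ x y : L, ⁅x, y⁆ = z} = ⊤ := by
  obtain ⟨ι, _, t, ht⟩ := h.exists_forall_spansAt
  have ht' : ∀ x, SpansAt ev (fun p : ι × ι ↦ ⁅t p.1, t p.2⁆) x := by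
    intro x
    rw [SpansAt, eq_top_iff, ← Atiyah.span_lie_eq_top 𝔤, Submodule.span_le]
    rintro _ ⟨y, z, rfl⟩
    have hy : y ∈ Submodule.span ℝ (range fun i ↦ ev x (t i)) := by
      rw [show Submodule.span ℝ (range fun i ↦ ev x (t i)) = ⊤ from ht x]; trivial
    have hz : z ∈ Submodule.span ℝ (range fun i ↦ ev x (t i)) := by
      rw [show Submodule.span ℝ (range fun i ↦ ev x (t i)) = ⊤ from ht x]; trivial
    obtain ⟨c, rfl⟩ := (Submodule.mem_span_range_iff_exists_fun ℝ).mp hy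
    obtain ⟨d, rfl⟩ := (Submodule.mem_span_range_iff_exists_fun ℝ).mp hz
    rw [SetLike.mem_coe, sum_lie]
    refine Submodule.sum_mem _ fun i _ ↦ ?_
    rw [lie_sum]
    refine Submodule.sum_mem _ fun j _ ↦ ?_
    rw [smul_lie, lie_smul]
    refine Submodule.smul_mem _ _ (Submodule.smul_mem _ _ (Submodule.subset_span ⟨(i, j), ?_⟩))
    exact LieHom.map_lie _ _ _
  rw [eq_top_iff]
  intro k _
  obtain ⟨f, hf, -⟩ := h.exists_eq_sum_act ht' k
  rw [hf]
  refine Submodule.sum_mem _ fun p _ ↦ Submodule.subset_span ?_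
  exact ⟨h.act (f p) (t p.1), t p.2, h.act_lie _ _ _⟩

variable [LieAlgebra.HasTrivialRadical ℝ 𝔤]

/-- The ideal `N = {x | [x, L] ⊆ J}` contains `J` and is not all of `L`, as `L` is perfect; so `N =
J`. For `k ∈ J` the identity `[f k, y] = [k, f y]` puts `f k` into `N`. -/
theorem act_mem (h : IsSectionAlgebra I F ev) {J : LieIdeal ℝ L}
    (hJ : IsMaximalFiniteCodimensional J) (f : C^∞⟮I, M; 𝓘(ℝ, ℝ), ℝ⟯) {k : L} (hk : k ∈ J) :
    h.act f k ∈ J := by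
  let N : LieIdeal ℝ L :=
    { carrier := {x | ∀ y, ⁅x, y⁆ ∈ J}
      add_mem' := fun {a b} ha hb y ↦ by rw [add_lie]; exact add_mem (ha y) (hb y)
      zero_mem' := fun y ↦ by rw [zero_lie]; exact zero_mem _
      smul_mem' := fun c x hx y ↦ by rw [smul_lie]; exact J.smul_mem c (hx y)
      lie_mem := fun {a b} hb y ↦ by
        rw [← lie_skew a b, neg_lie]
        exact neg_mem (lie_mem_left ℝ L J ⁅b, a⁆ y (hb a)) }
  have hJN : J ≤ N := fun x hx y ↦ lie_mem_left ℝ L J x y hx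
  have hN : N = J := by
    refine (hJ.eq_or_eq_top hJN).resolve_right fun hN ↦ hJ.prop.1 ?_
    have : Submodule.span ℝ {z : L | ∃ x y : L, ⁅x, y⁆ = z} ≤ J.toSubmodule := by
      rw [Submodule.span_le]
      rintro _ ⟨x, y, rfl⟩
      have hx : x ∈ N := by rw [hN]; exact LieSubmodule.mem_top x
      exact hx y
    rw [h.span_lie_eq_top, top_le_iff] at this
    exact LieSubmodule.toSubmodule_injective this
  have : h.act f k ∈ N := fun y ↦ by
    rw [h.act_lie, ← h.lie_act]
    exact lie_mem_left ℝ L J k _ hk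
  rwa [hN] at this

/-- The action of smooth functions on the quotient by a maximal finite-codimensional ideal. -/
def quotientAct (h : IsSectionAlgebra I F ev) {J : LieIdeal ℝ L}
    (hJ : IsMaximalFiniteCodimensional J) :
    C^∞⟮I, M; 𝓘(ℝ, ℝ), ℝ⟯ →ₐ[ℝ] Module.End ℝ (L ⧸ J.toSubmodule) :=
  AlgHom.ofLinearMap
    { toFun := fun f ↦ J.toSubmodule.mapQ J.toSubmodule (h.act f) fun _ hk ↦ h.act_mem hJ f hk
      map_add' := fun f g ↦ by
        ext k
        simp
      map_smul' := fun c f ↦ by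
        ext k
        simp }
    (by ext k; simp)
    (fun f g ↦ by ext k; simp)

theorem quotientAct_mk (h : IsSectionAlgebra I F ev) {J : LieIdeal ℝ L}
    (hJ : IsMaximalFiniteCodimensional J) (f : C^∞⟮I, M; 𝓘(ℝ, ℝ), ℝ⟯) (k : L) :
    h.quotientAct hJ f (Submodule.Quotient.mk k) = Submodule.Quotient.mk (h.act f k) := rfl

theorem quotientAct_eq_zero_iff (h : IsSectionAlgebra I F ev) {J : LieIdeal ℝ L}
    (hJ : IsMaximalFiniteCodimensional J) (f : C^∞⟮I, M; 𝓘(ℝ, ℝ), ℝ⟯) :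
    h.quotientAct hJ f = 0 ↔ ∀ k, h.act f k ∈ J := by
  constructor
  · intro hf k
    have := LinearMap.congr_fun hf (Submodule.Quotient.mk k)
    rw [quotientAct_mk, LinearMap.zero_apply, Submodule.Quotient.mk_eq_zero] at this
    exact this
  · intro hf
    ext k
    exact (Submodule.Quotient.mk_eq_zero _).mpr (hf k)

/-- A form of Schur's lemma: `{x | f x ∈ J}` is an ideal above `J`, so it is `J` or everything. -/
theorem quotientAct_ker_eq_bot (h : IsSectionAlgebra I F ev) {J : LieIdeal ℝ L}
    (hJ : IsMaximalFiniteCodimensional J) {f : C^∞⟮I, M; 𝓘(ℝ, ℝ), ℝ⟯}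
    (hf : h.quotientAct hJ f ≠ 0) : LinearMap.ker (h.quotientAct hJ f) = ⊥ := by
  let N : LieIdeal ℝ L :=
    { J.toSubmodule.comap (h.act f) with
      lie_mem := fun {a b} hb ↦ by
        change h.act f ⁅a, b⁆ ∈ J
        rw [← h.lie_act]
        exact J.lie_mem hb }
  have hJN : J ≤ N := fun x hx ↦ h.act_mem hJ f hx
  rcases hJ.eq_or_eq_top hJN with hN | hN
  · rw [LinearMap.ker_eq_bot']
    intro x
    induction x using Submodule.Quotient.induction_on with
    | H x =>
      intro hx
      rw [quotientAct_mk, Submodule.Quotient.mk_eq_zero] at hx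
      rw [Submodule.Quotient.mk_eq_zero]
      have : x ∈ N := hx
      rwa [hN] at this
  · refine absurd ((h.quotientAct_eq_zero_iff hJ f).mpr fun k ↦ ?_) hf
    have : k ∈ N := by rw [hN]; exact LieSubmodule.mem_top k
    exact this

theorem quotientAct_aeval_minpoly (h : IsSectionAlgebra I F ev) {J : LieIdeal ℝ L}
    (hJ : IsMaximalFiniteCodimensional J) (f : C^∞⟮I, M; 𝓘(ℝ, ℝ), ℝ⟯) :
    h.quotientAct hJ (Polynomial.aeval f (minpoly ℝ (h.quotientAct hJ f))) = 0 := by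
  rw [← Polynomial.aeval_algHom_apply, minpoly.aeval]

/-- Without a common zero, the functions acting as zero would contain a positive one, obtained as a
sum of squares. It is invertible, so `1` would act as zero and `J` would be everything. -/
theorem exists_forall_apply_eq_zero (h : IsSectionAlgebra I F ev) {J : LieIdeal ℝ L}
    (hJ : IsMaximalFiniteCodimensional J) :
    ∃ m : M, ∀ f : C^∞⟮I, M; 𝓘(ℝ, ℝ), ℝ⟯, h.quotientAct hJ f = 0 → f m = 0 := by
  by_contra! hne
  have := hJ.prop.2
  obtain ⟨ρ, hρ⟩ := exists_exhaustion (I := I) (M := M)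
  -- The function `p(ρ)` acts as zero and vanishes only where `ρ` is a root of `p`, thus inside a
  -- compact sublevel set of `ρ`. Finitely many squares suffice to be positive there.
  let p := minpoly ℝ (h.quotientAct hJ ρ)
  have hp : p ≠ 0 := minpoly.ne_zero (Algebra.IsIntegral.isIntegral _)
  obtain ⟨c, hc⟩ := (p.roots.toFinset.finite_toSet).bddAbove
  have hcover : ∃ g : C^∞⟮I, M; 𝓘(ℝ, ℝ), ℝ⟯, h.quotientAct hJ g = 0 ∧ (∀ x, 0 ≤ g x) ∧
      ∀ x ∈ ρ ⁻¹' Iic c, 0 < g x := by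
    refine (hρ c).induction_on ?_ ?_ ?_ ?_
    · exact ⟨0, map_zero _, fun x ↦ le_rfl, by simp⟩
    · rintro s t hst ⟨g, hg, hg0, hgt⟩
      exact ⟨g, hg, hg0, fun x hx ↦ hgt x (hst hx)⟩
    · rintro s t ⟨g, hg, hg0, hgs⟩ ⟨g', hg', hg0', hgt'⟩
      refine ⟨g + g', by rw [map_add, hg, hg', add_zero],
        fun x ↦ add_nonneg (hg0 x) (hg0' x), ?_⟩
      rintro x (hx | hx)
      · exact add_pos_of_pos_of_nonneg (hgs x hx) (hg0' x)
      · exact add_pos_of_nonneg_of_pos (hg0 x) (hgt' x hx)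
    · intro m _
      obtain ⟨f, hf, hfm⟩ := hne m
      refine ⟨{x | f x ≠ 0}, mem_nhdsWithin_of_mem_nhds ?_, f * f, ?_, ?_, ?_⟩
      · exact f.contMDiff.continuous.continuousAt.eventually_ne hfm
      · rw [map_mul, hf, zero_mul]
      · exact fun x ↦ mul_self_nonneg _
      · exact fun x hx ↦ mul_self_pos.mpr hx
  obtain ⟨g, hg, hg0, hgc⟩ := hcover
  let q := Polynomial.aeval ρ p
  have hq : h.quotientAct hJ q = 0 := h.quotientAct_aeval_minpoly hJ ρ
  have hpos : ∀ x, 0 < (g + q * q) x := by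
    intro x
    change 0 < g x + q x * q x
    by_cases hqx : q x = 0
    · have hx : ρ x ∈ p.roots.toFinset := by
        rw [Multiset.mem_toFinset, Polynomial.mem_roots hp, Polynomial.IsRoot, ← aeval_apply]
        exact hqx
      exact add_pos_of_pos_of_nonneg (hgc x (hc hx)) (mul_self_nonneg _)
    · exact add_pos_of_nonneg_of_pos (hg0 x) (mul_self_pos.mpr hqx)
  let r : C^∞⟮I, M; 𝓘(ℝ, ℝ), ℝ⟯ :=
    ⟨fun x ↦ ((g + q * q) x)⁻¹, (g + q * q).contMDiff.inv₀ fun x ↦ (hpos x).ne'⟩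
  have hr : r * (g + q * q) = 1 := by
    ext x
    exact inv_mul_cancel₀ (hpos x).ne'
  have h1 : h.quotientAct hJ 1 = 0 := by
    rw [← hr, map_mul, map_add, map_mul, hg, hq]
    simp
  apply hJ.prop.1
  rw [eq_top_iff]
  intro k _
  have := (h.quotientAct_eq_zero_iff hJ 1).mp h1 k
  rwa [map_one] at this

/-- A maximal finite-codimensional ideal contains all sections that vanish at a certain point. -/
theorem exists_ker_ev_le (h : IsSectionAlgebra I F ev) {J : LieIdeal ℝ L}
    (hJ : IsMaximalFiniteCodimensional J) : ∃ m : M, ∀ k, ev m k = 0 → k ∈ J := by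
  have := hJ.prop.2
  obtain ⟨m, hm⟩ := h.exists_forall_apply_eq_zero hJ
  -- Evaluating `p(f)` at `m`, for the minimal polynomial `p` of the action of `f`, shows that `0`
  -- is an eigenvalue; an injective action is thereby excluded.
  have hker : ∀ f : C^∞⟮I, M; 𝓘(ℝ, ℝ), ℝ⟯, f m = 0 → h.quotientAct hJ f = 0 := by
    intro f hf
    by_contra hne
    have h1 := hm _ (h.quotientAct_aeval_minpoly hJ f)
    rw [aeval_apply, hf] at h1
    have h2 : (h.quotientAct hJ f).HasEigenvalue 0 := Module.End.hasEigenvalue_of_isRoot h1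
    exact h2 ((Module.End.eigenspace_zero _).trans (h.quotientAct_ker_eq_bot hJ hne))
  obtain ⟨ι, _, t, ht⟩ := h.exists_forall_spansAt
  refine ⟨m, fun k hk ↦ ?_⟩
  obtain ⟨f, hf, hf0⟩ := h.exists_eq_sum_act ht k
  rw [hf]
  exact sum_mem fun i _ ↦ (h.quotientAct_eq_zero_iff hJ _).mp (hker _ (hf0 m hk i)) _

theorem isMaximalFiniteCodimensional_iff (h : IsSectionAlgebra I F ev) (J : LieIdeal ℝ L) :
    IsMaximalFiniteCodimensional J ↔
      ∃ (m : M) (g₀ : LieIdeal ℝ 𝔤), IsCoatom g₀ ∧ J = LieIdeal.comap (ev m) g₀ := by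
  constructor
  · intro hJ
    obtain ⟨m, hm⟩ := h.exists_ker_ev_le hJ
    exact ⟨m, _, isCoatom_map (h.surjective m) hJ hm,
      (comap_map_of_surjective (h.surjective m) hm).symm⟩
  · rintro ⟨m, g₀, hg, rfl⟩
    exact isMaximalFiniteCodimensional_comap (h.surjective m) hg

end IsSectionAlgebra

end Sections

/-! ### Brackets of related vector fields -/

section RelatedFields

variable {E : Type*} [NormedAddCommGroup E] [NormedSpace ℝ E]
  {H : Type*} [TopologicalSpace H] {I : ModelWithCorners ℝ E H}
  {P : Type*} [TopologicalSpace P] [ChartedSpace H P] [IsManifold I ∞ P]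

theorem contMDiff_mvfderiv_apply {f : P → ℝ} {V : ∀ y : P, TangentSpace I y}
    (hf : ContMDiff I 𝓘(ℝ, ℝ) ∞ f)
    (hV : ContMDiff I I.tangent 2 (fun y ↦ (V y : TangentBundle I P))) :
    ContMDiff I 𝓘(ℝ, ℝ) 2 (fun y ↦ mvfderiv I f y (V y)) := by
  have h1 : ContMDiff I.tangent 𝓘(ℝ, ℝ).tangent 2 (tangentMap I 𝓘(ℝ, ℝ) f) :=
    hf.contMDiff_tangentMap (m := 2) (by norm_cast)
  have h2 : ContMDiff 𝓘(ℝ, ℝ).tangent 𝓘(ℝ, ℝ) 2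
      (fun p : TangentBundle 𝓘(ℝ, ℝ) ℝ ↦ p.2) := contMDiff_snd_tangentBundle_modelSpace ℝ 𝓘(ℝ, ℝ)
  exact h2.comp (h1.comp hV)

/-- Linear functionals of a chart separate tangent vectors, and a bump function extends them to
global smooth functions. -/
theorem eq_zero_of_forall_mfderiv_eq_zero [FiniteDimensional ℝ E] [T2Space P] {x : P}
    {w : TangentSpace I x}
    (hw : ∀ f : P → ℝ, ContMDiff I 𝓘(ℝ, ℝ) ∞ f → mfderiv I 𝓘(ℝ, ℝ) f x w = 0) : w = 0 := by
  have hinj : Function.Injective (mfderiv I 𝓘(ℝ, E) (extChartAt I x) x) :=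
    (isInvertible_mfderiv_extChartAt (mem_extChartAt_source x)).injective
  apply hinj
  rw [map_zero]
  by_contra hne
  have hsep : ∀ z : E, z ≠ 0 → ∃ ℓ : E →L[ℝ] ℝ, ℓ z ≠ 0 := fun z hz ↦
    SeparatingDual.exists_ne_zero hz
  obtain ⟨ℓ, hℓ⟩ := hsep _ hne
  let χ : SmoothBumpFunction I x := Classical.arbitrary _
  have hs : ContMDiffOn I 𝓘(ℝ, ℝ) ∞ (fun y ↦ ℓ (extChartAt I x y)) (chartAt H x).source :=
    ℓ.contMDiff.comp_contMDiffOn (contMDiffOn_extChartAt)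
  have hd : HasMFDerivAt I 𝓘(ℝ, ℝ) (fun y ↦ ℓ (extChartAt I x y)) x _ :=
    (ℓ.hasMFDerivAt (x := extChartAt I x x)).comp x
      (mdifferentiableAt_extChartAt (mem_chart_source H x)).hasMFDerivAt
  have he : (fun y ↦ χ y • ℓ (extChartAt I x y)) =ᶠ[𝓝 x] fun y ↦ ℓ (extChartAt I x y) := by
    filter_upwards [χ.eventuallyEq_one] with y hy
    rw [hy]
    exact one_smul _ _
  have := hw _ (χ.contMDiff_smul hs)
  rw [he.mfderiv_eq, hd.mfderiv] at this
  exact hℓ this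

variable [CompleteSpace E]

/-- The bracket of vector fields is the commutator of the directional derivatives. -/
theorem mvfderiv_mlieBracket {f : P → ℝ} {V W : ∀ y : P, TangentSpace I y}
    (hf : ContMDiff I 𝓘(ℝ, ℝ) ∞ f)
    (hV : ContMDiff I I.tangent 2 (fun y ↦ (V y : TangentBundle I P)))
    (hW : ContMDiff I I.tangent 2 (fun y ↦ (W y : TangentBundle I P))) (x : P) :
    mvfderiv I f x (mlieBracket I V W x) =
      mvfderiv I (fun y ↦ mvfderiv I f y (W y)) x (V x) -
        mvfderiv I (fun y ↦ mvfderiv I f y (V y)) x (W x) := by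
  have hfd : ∀ y, MDifferentiableAt I 𝓘(ℝ, ℝ) f y := fun y ↦ (hf y).mdifferentiableAt (by simp)
  have hb : ∀ {V W : ∀ y : P, TangentSpace I y},
      ContMDiff I I.tangent 2 (fun y ↦ (V y : TangentBundle I P)) →
      ContMDiff I I.tangent 2 (fun y ↦ (W y : TangentBundle I P)) →
      ContMDiff I I.tangent 1 (fun y ↦ (mlieBracket I V W y : TangentBundle I P)) := by
    intro V W hV hW
    have : IsManifold I (((2 : ℕ∞) : WithTop ℕ∞) + 1) P := by
      exact IsManifold.of_le (n := ∞) (by norm_cast)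
    exact ContDiff.mlieBracket_vectorField (m := 1) (n := 2) hV hW (by simp; norm_cast)
  have hs : ∀ {V : ∀ y : P, TangentSpace I y},
      ContMDiff I I.tangent 2 (fun y ↦ (V y : TangentBundle I P)) →
      ContMDiffAt I I.tangent (minSmoothness ℝ 2) (fun y ↦ (V y : TangentBundle I P)) x :=
    fun hV ↦ by simpa using hV x
  have hm : ∀ {V : ∀ y : P, TangentSpace I y},
      ContMDiff I I.tangent 2 (fun y ↦ (V y : TangentBundle I P)) → ∀ y,
      MDifferentiableAt I I.tangent (fun y ↦ (V y : TangentBundle I P)) y :=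
    fun hV y ↦ (hV y).mdifferentiableAt (by simp)
  -- The Jacobi identity for `V`, `W` and `f • U` is expanded by the Leibniz rule; what remains
  -- after subtracting `f` times the identity for `V`, `W`, `U` is the claim multiplied by `U x`.
  have key : ∀ U : ∀ y : P, TangentSpace I y,
      ContMDiff I I.tangent 2 (fun y ↦ (U y : TangentBundle I P)) →
      (mvfderiv I f x (mlieBracket I V W x)) • U x =
      (mvfderiv I (fun y ↦ mvfderiv I f y (W y)) x (V x) -
        mvfderiv I (fun y ↦ mvfderiv I f y (V y)) x (W x)) • U x := by
    intro U hU
    have hfU : ContMDiff I I.tangent 2 (fun y ↦ ((f • U) y : TangentBundle I P)) :=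
      ContMDiff.smul_section (hf.of_le (by norm_cast)) hU
    have J := leibniz_identity_mlieBracket_apply (I := I) (hs hV) (hs hW) (hs hfU)
    have expand : ∀ A B : ∀ y : P, TangentSpace I y,
        ContMDiff I I.tangent 2 (fun y ↦ (A y : TangentBundle I P)) →
        ContMDiff I I.tangent 2 (fun y ↦ (B y : TangentBundle I P)) →
        mlieBracket I A (mlieBracket I B (f • U)) x =
          mvfderiv I (fun y ↦ mvfderiv I f y (B y)) x (A x) • U x +
          mvfderiv I f x (B x) • mlieBracket I A U x +
          (mvfderiv I f x (A x) • mlieBracket I B U x +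
          f x • mlieBracket I A (mlieBracket I B U) x) := by
      intro A B hA hB
      have e : mlieBracket I B (f • U) = (fun y ↦ mvfderiv I f y (B y)) • U +
          f • mlieBracket I B U := by
        funext y
        exact mlieBracket_smul_right (hfd y) (hm hU y)
      have hd : MDifferentiableAt I 𝓘(ℝ, ℝ) (fun y ↦ mvfderiv I f y (B y)) x :=
        (contMDiff_mvfderiv_apply hf hB x).mdifferentiableAt (by simp)
      have hbU : MDifferentiableAt I I.tangent
          (fun y ↦ (mlieBracket I B U y : TangentBundle I P)) x :=
        (hb hB hU x).mdifferentiableAt (by simp)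
      rw [e, mlieBracket_add_right (hd.smul_section (hm hU x)) ((hfd x).smul_section hbU),
        mlieBracket_smul_right hd (hm hU x), mlieBracket_smul_right (hfd x) hbU]
    have e3 : mlieBracket I (mlieBracket I V W) (f • U) x =
        mvfderiv I f x (mlieBracket I V W x) • U x + f x • mlieBracket I (mlieBracket I V W) U x :=
      mlieBracket_smul_right (hfd x) (hm hU x)
    have e4 := leibniz_identity_mlieBracket_apply (I := I) (hs hV) (hs hW) (hs hU)
    rw [expand V W hV hW, expand W V hW hV, e3, e4, smul_add] at J
    rw [sub_smul, eq_sub_iff_add_eq]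
    generalize mvfderiv I f x (mlieBracket I V W x) • U x = a at J ⊢
    generalize mvfderiv I (fun y ↦ mvfderiv I f y (W y)) x (V x) • U x = b at J ⊢
    generalize mvfderiv I (fun y ↦ mvfderiv I f y (V y)) x (W x) • U x = c at J ⊢
    generalize mvfderiv I f x (W x) • mlieBracket I V U x = d at J
    generalize mvfderiv I f x (V x) • mlieBracket I W U x = d' at J
    generalize f x • mlieBracket I (mlieBracket I V W) U x = d₁ at J
    generalize f x • mlieBracket I W (mlieBracket I V U) x = d₂ at J
    have h5 : b + (d + d' + d₁ + d₂) = a + c + (d + d' + d₁ + d₂) := by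
      calc b + (d + d' + d₁ + d₂) = b + d + (d' + (d₁ + d₂)) := by abel
        _ = _ := J
        _ = _ := by abel
    exact (add_right_cancel h5).symm
  -- The scalar can be cancelled when `U x ≠ 0`; `V` or `W` itself serves as `U`, unless both vanish
  -- at `x`, where the bracket vanishes as well.
  by_cases h1 : V x = 0
  · by_cases h2 : W x = 0
    · have : mlieBracket I V W x = 0 := by
        rw [← mlieBracketWithin_univ]
        exact mlieBracketWithin_eq_zero_of_eq_zero h1 h2
      rw [this, h1, h2, map_zero, map_zero, map_zero, sub_zero]
    · exact smul_left_injective ℝ h2 (key W hW)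
  · exact smul_left_injective ℝ h1 (key V hV)

variable {E' : Type*} [NormedAddCommGroup E'] [NormedSpace ℝ E'] [CompleteSpace E']
  {H' : Type*} [TopologicalSpace H'] {I' : ModelWithCorners ℝ E' H'}
  {Q : Type*} [TopologicalSpace Q] [ChartedSpace H' Q] [IsManifold I' ∞ Q] {j : Q → P}

/-- Brackets of `j`-related vector fields are `j`-related. -/
theorem mlieBracket_of_related [FiniteDimensional ℝ E] [T2Space P]
    (hj : ContMDiff I' I ∞ j) {V W : ∀ y : Q, TangentSpace I' y} {V' W' : ∀ y : P, TangentSpace I y}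
    (hV : ContMDiff I' I'.tangent 2 (fun y ↦ (V y : TangentBundle I' Q)))
    (hW : ContMDiff I' I'.tangent 2 (fun y ↦ (W y : TangentBundle I' Q)))
    (hV' : ContMDiff I I.tangent 2 (fun y ↦ (V' y : TangentBundle I P)))
    (hW' : ContMDiff I I.tangent 2 (fun y ↦ (W' y : TangentBundle I P)))
    (hVV : ∀ q, V' (j q) = mfderiv I' I j q (V q)) (hWW : ∀ q, W' (j q) = mfderiv I' I j q (W q))
    (q : Q) : mlieBracket I V' W' (j q) = mfderiv I' I j q (mlieBracket I' V W q) := by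
  rw [← sub_eq_zero]
  refine eq_zero_of_forall_mfderiv_eq_zero fun f hf ↦ ?_
  rw [map_sub, sub_eq_zero]
  have hjd : ∀ q, MDifferentiableAt I' I j q := fun q ↦ (hj q).mdifferentiableAt (by simp)
  have hfd : ∀ y, MDifferentiableAt I 𝓘(ℝ, ℝ) f y := fun y ↦ (hf y).mdifferentiableAt (by simp)
  have comp : ∀ (g : P → ℝ), (∀ y, MDifferentiableAt I 𝓘(ℝ, ℝ) g y) → ∀ (q : Q)
      (v : TangentSpace I' q), mvfderiv I' (g ∘ j) q v = mvfderiv I g (j q) (mfderiv I' I j q v) :=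
    fun g hg q v ↦ mfderiv_comp_apply q (hg _) (hjd q) v
  have dir : ∀ (A : ∀ y : Q, TangentSpace I' y) (A' : ∀ y : P, TangentSpace I y),
      (∀ q, A' (j q) = mfderiv I' I j q (A q)) →
      (fun q ↦ mvfderiv I' (f ∘ j) q (A q)) = (fun y ↦ mvfderiv I f y (A' y)) ∘ j := by
    intro A A' hA
    funext q
    rw [comp f hfd, ← hA]
    rfl
  have h1 := mvfderiv_mlieBracket hf hV' hW' (j q)
  have h2 := mvfderiv_mlieBracket (hf.comp hj) hV hW q
  rw [dir W W' hWW, dir V V' hVV, comp f hfd,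
    comp _ fun y ↦ (contMDiff_mvfderiv_apply hf hW' y).mdifferentiableAt (by simp),
    comp _ fun y ↦ (contMDiff_mvfderiv_apply hf hV' y).mdifferentiableAt (by simp),
    ← hVV, ← hWW] at h2
  exact h1.trans h2.symm

end RelatedFields

/-! ### Right invariant vector fields on a Lie group -/

section RightInvariant

variable {E : Type*} [NormedAddCommGroup E] [NormedSpace ℝ E]
  {H : Type*} [TopologicalSpace H] {I : ModelWithCorners ℝ E H}
  {G : Type*} [TopologicalSpace G] [ChartedSpace H G] [Group G] [LieGroup I ∞ G]

theorem mdifferentiableAt_inv (g : G) : MDifferentiableAt I I (fun x : G ↦ x⁻¹) g :=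
  (contMDiff_inv I ∞ g).mdifferentiableAt (by simp)

theorem mdifferentiableAt_mul_left (a g : G) : MDifferentiableAt I I (fun x : G ↦ a * x) g :=
  ((contMDiff_mul_left (I := I) (n := ∞)) g).mdifferentiableAt (by simp)

theorem mdifferentiableAt_mul_right (a g : G) : MDifferentiableAt I I (fun x : G ↦ x * a) g :=
  ((contMDiff_mul_right (I := I) (n := ∞)) g).mdifferentiableAt (by simp)

/-- Differentiate `x * x⁻¹ = 1` at `x = 1`. -/
theorem mfderiv_inv_one (h : GroupLieAlgebra I G) :
    (mfderiv I I (fun x : G ↦ x⁻¹) 1 h : E) = -(h : E) := by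
  have hmul : MDifferentiableAt (I.prod I) I (fun p : G × G ↦ p.1 * p.2) ((1 : G), (1 : G)⁻¹) :=
    (contMDiff_mul I ∞ _).mdifferentiableAt (by simp)
  have hpair : HasMFDerivAt I (I.prod I) (fun x : G ↦ (x, x⁻¹)) (1 : G) _ :=
    (hasMFDerivAt_id (1 : G)).prodMk (mdifferentiableAt_inv (1 : G)).hasMFDerivAt
  have hcomp := hmul.hasMFDerivAt.comp (1 : G) hpair
  have hconst : ((fun p : G × G ↦ p.1 * p.2) ∘ fun x : G ↦ (x, x⁻¹)) = fun _ ↦ (1 : G) := by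
    funext x
    simp
  rw [hconst] at hcomp
  have h0 := hasMFDerivAt_unique hcomp (hasMFDerivAt_const (1 : G) (1 : G))
  have h1 := DFunLike.congr_fun h0 h
  let a : E := h
  let b : E := mfderiv I I (fun x : G ↦ x⁻¹) 1 h
  let p : E × E := (a, b)
  have h2 := mfderiv_prod_eq_add_apply hmul (v := p)
  have h3 : (mfderiv I I (fun z : G ↦ z * (1 : G)⁻¹) 1 h : E) = h := by
    have : (fun z : G ↦ z * (1 : G)⁻¹) = id := by funext z; simp
    rw [this, mfderiv_id]
    rfl
  have h4 : ∀ w : TangentSpace I ((1 : G)⁻¹),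
      (mfderiv I I (fun z : G ↦ (1 : G) * z) (1 : G)⁻¹ w : E) = w := by
    intro w
    have : (fun z : G ↦ (1 : G) * z) = id := by funext z; simp
    rw [this, mfderiv_id]
    rfl
  have h5 : (0 : E) = a + b := by
    refine Eq.trans (Eq.symm h1) (Eq.trans h2 ?_)
    exact congrArg₂ (fun a b : E ↦ a + b) h3 (h4 _)
  exact (neg_eq_of_add_eq_zero_right h5.symm).symm

/-- The pullback under inversion of the left invariant vector field with value `h` at `1`: the
right invariant vector field with value `-h` at `1`. -/
def invPullback (h : GroupLieAlgebra I G) : ∀ g : G, TangentSpace I g :=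
  mpullback I I (fun x : G ↦ x⁻¹) (mulInvariantVectorField h)

theorem mfderiv_inv_comp {a b : G} (hab : a⁻¹ = b) :
    (mfderiv I I (fun x : G ↦ x⁻¹) b : E →L[ℝ] E).comp (mfderiv I I (fun x : G ↦ x⁻¹) a) =
      ContinuousLinearMap.id ℝ E := by
  subst hab
  have := mfderiv_comp (I := I) (I' := I) (I'' := I) a (mdifferentiableAt_inv (I := I) a⁻¹)
    (mdifferentiableAt_inv (I := I) a)
  have h2 : ((fun x : G ↦ x⁻¹) ∘ fun x : G ↦ x⁻¹) = id := by funext x; simp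
  rw [h2, mfderiv_id] at this
  exact this.symm

theorem inverse_mfderiv_inv (g : G) :
    (mfderiv I I (fun x : G ↦ x⁻¹) g).inverse = mfderiv I I (fun x : G ↦ x⁻¹) g⁻¹ :=
  ContinuousLinearMap.inverse_eq (mfderiv_inv_comp (inv_inv g)) (mfderiv_inv_comp rfl)

theorem isInvertible_mfderiv_inv (g : G) : (mfderiv I I (fun x : G ↦ x⁻¹) g).IsInvertible :=
  .of_inverse (g := mfderiv I I (fun x : G ↦ x⁻¹) g⁻¹) (mfderiv_inv_comp (inv_inv g))
    (mfderiv_inv_comp rfl)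

/-- Inversion turns left translation by `g⁻¹` into right translation by `g`; the sign is the
derivative of inversion at `1`. -/
theorem invPullback_apply (h : GroupLieAlgebra I G) (g : G) :
    (invPullback h g : E) =
      mfderiv I I (fun x : G ↦ x * g) 1 (-h : GroupLieAlgebra I G) := by
  have h1 : (invPullback h g : E) =
      mfderiv I I (fun x : G ↦ x⁻¹) g⁻¹ (mulInvariantVectorField h g⁻¹) := by
    rw [invPullback, mpullback_apply, inverse_mfderiv_inv]
    rfl
  have h2 : mfderiv I I ((fun x : G ↦ x⁻¹) ∘ (fun x : G ↦ g⁻¹ * x)) 1 h =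
      mfderiv I I (fun x : G ↦ x⁻¹) g⁻¹ (mulInvariantVectorField h g⁻¹) :=
    mfderiv_comp_apply_of_eq (1 : G) (mdifferentiableAt_inv (I := I) g⁻¹)
      (mdifferentiableAt_mul_left g⁻¹ 1) (mul_one _) h
  have h3 : ((fun x : G ↦ x⁻¹) ∘ (fun x : G ↦ g⁻¹ * x)) =
      (fun x : G ↦ x * g) ∘ (fun x : G ↦ x⁻¹) := by
    funext x
    simp
  have h4 : mfderiv I I ((fun x : G ↦ x * g) ∘ (fun x : G ↦ x⁻¹)) 1 h =
      mfderiv I I (fun x : G ↦ x * g) 1 (mfderiv I I (fun x : G ↦ x⁻¹) 1 h) :=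
    mfderiv_comp_apply_of_eq (1 : G) (mdifferentiableAt_mul_right (I := I) g 1)
      (mdifferentiableAt_inv 1) inv_one h
  rw [h1]
  refine Eq.trans h2.symm ?_
  rw [h3]
  refine Eq.trans h4 ?_
  exact congrArg (fun w : E ↦ (mfderiv I I (fun x : G ↦ x * g) 1 : E →L[ℝ] E) w)
    (mfderiv_inv_one h)

variable [CompleteSpace E]

theorem contMDiff_invPullback (h : GroupLieAlgebra I G) :
    ContMDiff I I.tangent 2 (fun g ↦ (invPullback h g : TangentBundle I G)) := by
  have hL : ContMDiff I I.tangent 2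
      (fun g ↦ (mulInvariantVectorField h g : TangentBundle I G)) := by
    simpa using contMDiff_mulInvariantVectorField h
  have : IsManifold I 3 G := IsManifold.of_le (n := ∞) (by norm_cast)
  exact ContMDiff.mpullback_vectorField (m := 2) (n := ∞) hL (contMDiff_inv I ∞)
    (fun g ↦ isInvertible_mfderiv_inv g) (by norm_cast)

/-- Pullback under a diffeomorphism preserves brackets, so this is the bracket of left invariant
fields, with the sign of inversion. -/
theorem mlieBracket_invPullback (h h' : GroupLieAlgebra I G) :
    (mlieBracket I (invPullback h) (invPullback h') (1 : G) : E) =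
      -(⁅h, h'⁆ : GroupLieAlgebra I G) := by
  have h1 := mpullback_mlieBracket (I := I) (I' := I) (n := ∞) (x₀ := (1 : G))
    (f := fun x : G ↦ x⁻¹)
    (mdifferentiableAt_mulInvariantVectorField h) (mdifferentiableAt_mulInvariantVectorField h')
    (contMDiff_inv I ∞ 1) ENat.LEInfty.out
  refine Eq.trans h1.symm ?_
  rw [← mulInvariantVector_mlieBracket]
  refine Eq.trans (invPullback_apply ⁅h, h'⁆ (1 : G)) ?_
  have : (fun x : G ↦ x * 1) = id := by funext x; simp
  rw [this, mfderiv_id]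
  rfl

end RightInvariant

/-! ### Smoothness of tangent maps -/

section TangentMap

variable {E : Type*} [NormedAddCommGroup E] [NormedSpace ℝ E]
  {H : Type*} [TopologicalSpace H] {I : ModelWithCorners ℝ E H}
  {N : Type*} [TopologicalSpace N] [ChartedSpace H N] [IsManifold I ∞ N]
  {E' : Type*} [NormedAddCommGroup E'] [NormedSpace ℝ E']
  {H' : Type*} [TopologicalSpace H'] {I' : ModelWithCorners ℝ E' H'}
  {N' : Type*} [TopologicalSpace N'] [ChartedSpace H' N']

theorem contMDiffAt_tangentMap [IsManifold I' ∞ N'] {f : N → N'} {O : Set N} (hO : IsOpen O)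
    (hf : ∀ y ∈ O, ContMDiffAt I I' ∞ f y) {p : TangentBundle I N} (hp : p.proj ∈ O) :
    ContMDiffAt I.tangent I'.tangent ∞ (tangentMap I I' f) p := by
  have h1 : ContMDiffOn I.tangent I'.tangent ∞ (tangentMapWithin I I' f O)
      (Bundle.TotalSpace.proj ⁻¹' O) :=
    ContMDiffOn.contMDiffOn_tangentMapWithin (n := ∞)
      (fun y hy ↦ (hf y hy).contMDiffWithinAt) (by simp) hO.uniqueMDiffOn
  have hO' : IsOpen (Bundle.TotalSpace.proj ⁻¹' O : Set (TangentBundle I N)) :=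
    hO.preimage (FiberBundle.continuous_proj E (TangentSpace I : N → Type _))
  refine (h1.contMDiffAt (hO'.mem_nhds hp)).congr_of_eventuallyEq ?_
  filter_upwards [hO'.mem_nhds hp] with z hz
  simp only [tangentMap, tangentMapWithin, mfderivWithin_of_isOpen hO hz]

/-- A smooth family of tangent vectors at a fixed point is smooth as a family of vectors. -/
theorem contMDiffAt_of_tangentBundle {x₀ : N'} {b : N} {X : N' → E}
    (hX : ContMDiffAt I' I.tangent ∞ (fun y ↦ (⟨b, X y⟩ : TangentBundle I N)) x₀) :
    ContMDiffAt I' 𝓘(ℝ, E) ∞ X x₀ := by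
  have h1 := (Bundle.contMDiffAt_totalSpace.mp hX).2
  refine h1.congr_of_eventuallyEq (Eventually.of_forall fun y ↦ ?_)
  exact (tangentCoordChange_self (I := I) (mem_extChartAt_source b)).symm

end TangentMap

/-! ### Local trivializations and fundamental vectors -/

variable {EM : Type*} [NormedAddCommGroup EM] [NormedSpace ℝ EM]
  {HM : Type*} [TopologicalSpace HM] {IM : ModelWithCorners ℝ EM HM}
  {EG : Type*} [NormedAddCommGroup EG] [NormedSpace ℝ EG]
  {HG : Type*} [TopologicalSpace HG] {IG : ModelWithCorners ℝ EG HG}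
  {EP : Type*} [NormedAddCommGroup EP] [NormedSpace ℝ EP]
  {HP : Type*} [TopologicalSpace HP] {IP : ModelWithCorners ℝ EP HP}
  {M : Type*} [TopologicalSpace M] [ChartedSpace HM M]
  {G : Type*} [TopologicalSpace G] [ChartedSpace HG G] [Group G]
  {P : Type*} [TopologicalSpace P] [ChartedSpace HP P] [MulAction Gᵐᵒᵖ P] {π : P → M}

/-- A smooth local trivialization over `U`, given by the component `q` in the group and the
parametrization `s` of `π ⁻¹ U`. -/
structure IsLocalTriv (IM : ModelWithCorners ℝ EM HM) (IG : ModelWithCorners ℝ EG HG)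
    (IP : ModelWithCorners ℝ EP HP) (π : P → M) (U : Set M) (q : P → G) (s : M × G → P) :
    Prop where
  isOpen : IsOpen U
  contMDiffAt_q : ∀ v, π v ∈ U → ContMDiffAt IP IG ∞ q v
  contMDiffAt_s : ∀ x ∈ U, ∀ g, ContMDiffAt (IM.prod IG) IP ∞ s (x, g)
  s_proj_q : ∀ v, π v ∈ U → s (π v, q v) = v
  proj_s : ∀ x ∈ U, ∀ g, π (s (x, g)) = x
  q_s : ∀ x ∈ U, ∀ g, q (s (x, g)) = g
  proj_act : ∀ v, π v ∈ U → ∀ a : G, π (v <• a) = π v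
  q_act : ∀ v, π v ∈ U → ∀ a : G, q (v <• a) = q v * a

namespace IsLocalTriv

variable {U : Set M} {q : P → G} {s : M × G → P}

theorem s_act (h : IsLocalTriv IM IG IP π U q s) {x : M} (hx : x ∈ U) (g a : G) :
    s (x, g) <• a = s (x, g * a) := by
  have h1 : π (s (x, g)) ∈ U := by rwa [h.proj_s x hx]
  have h2 : π (s (x, g) <• a) = x := by rw [h.proj_act _ h1, h.proj_s x hx]
  rw [← h.s_proj_q (s (x, g) <• a) (by rwa [h2]), h2, h.q_act _ h1, h.q_s x hx]

end IsLocalTriv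

namespace IsPrincipalBundle

theorem exists_localTriv (hP : IsPrincipalBundle IM IG IP G π) (m : M) :
    ∃ (U : Set M) (q : P → G) (s : M × G → P), m ∈ U ∧ IsLocalTriv IM IG IP π U q s := by
  obtain ⟨U, e, hU, hm, hs, ht, he, he', hπ, hact⟩ := hP.exists_trivialization m
  have hsrc : ∀ v, v ∈ e.source ↔ π v ∈ U := fun v ↦ by rw [hs]; rfl
  have htgt : ∀ x ∈ U, ∀ g : G, (x, g) ∈ e.target := fun x hx g ↦ by
    rw [ht]; exact ⟨hx, trivial⟩
  refine ⟨U, fun v ↦ (e v).2, e.symm, hm, hU, ?_, ?_, ?_, ?_, ?_, ?_, ?_⟩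
  · intro v hv
    exact (he.contMDiffAt (e.open_source.mem_nhds ((hsrc v).mpr hv))).snd
  · intro x hx g
    exact he'.contMDiffAt (e.open_target.mem_nhds (htgt x hx g))
  · intro v hv
    rw [← hπ v ((hsrc v).mpr hv)]
    exact e.left_inv ((hsrc v).mpr hv)
  · intro x hx g
    rw [← hπ _ (e.map_target (htgt x hx g)), e.right_inv (htgt x hx g)]
  · intro x hx g
    rw [e.right_inv (htgt x hx g)]
  · intro v hv a
    have := hact v ((hsrc v).mpr hv) a
    rw [← hπ _ this.1, this.2, ← hπ _ ((hsrc v).mpr hv)]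
  · intro v hv a
    have := hact v ((hsrc v).mpr hv) a
    rw [this.2]

theorem proj_act (hP : IsPrincipalBundle IM IG IP G π) (u : P) (g : G) : π (u <• g) = π u := by
  obtain ⟨U, q, s, hu, h⟩ := hP.exists_localTriv (π u)
  exact h.proj_act u hu g

theorem exists_act_eq (hP : IsPrincipalBundle IM IG IP G π) {u v : P} (huv : π u = π v) :
    ∃ g : G, u <• g = v := by
  obtain ⟨U, q, s, hu, h⟩ := hP.exists_localTriv (π u)
  refine ⟨(q u)⁻¹ * q v, ?_⟩
  rw [← h.s_proj_q (u <• ((q u)⁻¹ * q v)) (by rwa [h.proj_act u hu]), h.proj_act u hu,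
    h.q_act u hu, mul_inv_cancel_left, huv]
  exact h.s_proj_q v (by rwa [← huv])

theorem contMDiff_orbit (hP : IsPrincipalBundle IM IG IP G π) (u : P) :
    ContMDiff IG IP ∞ (fun g : G ↦ u <• g) :=
  hP.contMDiff_act.comp (contMDiff_const.prodMk contMDiff_id)

theorem mdifferentiableAt_orbit (hP : IsPrincipalBundle IM IG IP G π) (u : P) (g : G) :
    MDifferentiableAt IG IP (fun g : G ↦ u <• g) g :=
  (hP.contMDiff_orbit u g).mdifferentiableAt (by simp)

theorem mdifferentiableAt_right (hP : IsPrincipalBundle IM IG IP G π) (g : G) (u : P) :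
    MDifferentiableAt IP IP (fun v : P ↦ v <• g) u :=
  (hP.contMDiff_right g u).mdifferentiableAt (by simp)

theorem mdifferentiableAt_proj (hP : IsPrincipalBundle IM IG IP G π) (u : P) :
    MDifferentiableAt IP IM π u :=
  (hP.contMDiff_proj u).mdifferentiableAt (by simp)

variable [LieGroup IG ∞ G]

/-- In a trivialization, `v ↦ (q u)⁻¹ * q v` is a left inverse of the orbit map of `u`. -/
theorem fundamentalMap_injective (hP : IsPrincipalBundle IM IG IP G π) (u : P) :
    Function.Injective (fundamentalMap (G := G) IG IP u) := by
  obtain ⟨U, q, s, hu, h⟩ := hP.exists_localTriv (π u)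
  have hu1 : π (u <• (1 : G)) ∈ U := by rwa [hP.proj_act]
  have hq : MDifferentiableAt IP IG (fun v ↦ (q u)⁻¹ * q v) (u <• (1 : G)) :=
    (mdifferentiableAt_mul_left (q u)⁻¹ (q (u <• (1 : G)))).comp _
      ((h.contMDiffAt_q _ hu1).mdifferentiableAt (by simp))
  have he : (fun v ↦ (q u)⁻¹ * q v) ∘ (fun g : G ↦ u <• g) = id := by
    funext g
    simp [h.q_act u hu]
  have hd := mfderiv_comp (1 : G) hq (hP.mdifferentiableAt_orbit u 1)
  rw [he, mfderiv_id] at hd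
  intro a b hab
  have ha := DFunLike.congr_fun hd a
  have hb := DFunLike.congr_fun hd b
  have hab' : mfderiv IG IP (fun g : G ↦ u <• g) 1 a = mfderiv IG IP (fun g : G ↦ u <• g) 1 b :=
    hab
  refine ha.trans (Eq.trans ?_ hb.symm)
  exact congrArg (mfderiv IP IG (fun v ↦ (q u)⁻¹ * q v) (u <• (1 : G))) hab'

/-- Vertical vectors are fundamental, with an explicit preimage. Near `u` one has `v = s (π v, q u)
<• ((q u)⁻¹ * q v)`; in the derivative at `u` the contribution of the base is zero on a vertical
vector, and the contribution of the group is a fundamental vector. -/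
theorem fundamentalMap_mfderiv (hP : IsPrincipalBundle IM IG IP G π) {U : Set M} {q : P → G}
    {s : M × G → P} (h : IsLocalTriv IM IG IP π U q s) {u : P} (hu : π u ∈ U)
    {w : TangentSpace IP u} (hw : mfderiv IP IM π u w = 0) :
    fundamentalMap (G := G) IG IP u (mfderiv IP IG (fun v ↦ (q u)⁻¹ * q v) u w : EG) = w := by
  let f : M × G → P := fun p ↦ s (p.1, q u) <• p.2
  have hf : MDifferentiableAt (IM.prod IG) IP f (π u, (1 : G)) := by
    have h1 : ContMDiffAt (IM.prod IG) IP ∞ (fun p : M × G ↦ s (p.1, q u)) (π u, (1 : G)) :=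
      ContMDiffAt.comp (π u, (1 : G)) (h.contMDiffAt_s (π u) hu (q u))
        (contMDiffAt_fst.prodMk contMDiffAt_const)
    exact ((hP.contMDiff_act.contMDiffAt).comp (π u, (1 : G))
      (h1.prodMk contMDiffAt_snd)).mdifferentiableAt (by simp)
  have hq : MDifferentiableAt IP IG (fun v ↦ (q u)⁻¹ * q v) u :=
    (mdifferentiableAt_mul_left (q u)⁻¹ (q u)).comp u
      ((h.contMDiffAt_q u hu).mdifferentiableAt (by simp))
  have hpair : HasMFDerivAt IP (IM.prod IG) (fun v ↦ (π v, (q u)⁻¹ * q v)) u _ :=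
    (hP.mdifferentiableAt_proj u).hasMFDerivAt.prodMk hq.hasMFDerivAt
  have hpt : (π u, (1 : G)) = (π u, (q u)⁻¹ * q u) := by simp
  have hcomp := (hpt ▸ hf).hasMFDerivAt.comp u hpair
  have hid : (f ∘ fun v ↦ (π v, (q u)⁻¹ * q v)) =ᶠ[𝓝 u] id := by
    filter_upwards [hP.contMDiff_proj.continuous.continuousAt.preimage_mem_nhds
      (h.isOpen.mem_nhds hu)] with v hv
    change s (π v, q u) <• ((q u)⁻¹ * q v) = v
    rw [h.s_act hv, mul_inv_cancel_left, h.s_proj_q v hv]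
  have hd := hasMFDerivAt_unique hcomp ((hasMFDerivAt_id u).congr_of_eventuallyEq hid)
  have hw1 := DFunLike.congr_fun hd w
  let p : EM × EG := (mfderiv IP IM π u w, mfderiv IP IG (fun v ↦ (q u)⁻¹ * q v) u w)
  have h2 := mfderiv_prod_eq_add_apply hf (v := p)
  have h3 : (fun z : G ↦ f (π u, z)) = fun g : G ↦ u <• g := by
    funext g
    change s (π u, q u) <• g = u <• g
    rw [h.s_proj_q u hu]
  have h4 : mfderiv IM IP (fun z : M ↦ f (z, (1 : G))) (π u) (mfderiv IP IM π u w) = 0 := by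
    rw [hw, map_zero]
  have hpt' : ∀ g : G, g = 1 → (mfderiv (IM.prod IG) IP f (π u, g) : EM × EG →L[ℝ] EP) p = w →
      (mfderiv (IM.prod IG) IP f (π u, (1 : G)) : EM × EG →L[ℝ] EP) p = w := by
    rintro g rfl hg
    exact hg
  have h5 := hpt' _ (inv_mul_cancel (q u)) hw1
  have h6 : (mfderiv IG IP (fun z : G ↦ f (π u, z)) 1 : EG →L[ℝ] EP) p.2 = w := by
    have h7 := h2.symm.trans h5
    have h8 : (mfderiv IM IP (fun z : M ↦ f (z, (1 : G))) (π u) : EM →L[ℝ] EP) p.1 = 0 := h4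
    let b : EP := (mfderiv IG IP (fun z : G ↦ f (π u, z)) 1 : EG →L[ℝ] EP) p.2
    have h9 := congrArg (fun a : EP ↦ a + b) h8
    exact ((zero_add b).symm.trans h9.symm).trans h7
  rw [h3] at h6
  exact h6

end IsPrincipalBundle

/-! ### Evaluation of the kernel at a point as a Lie morphism -/

namespace IsPrincipalBundle

variable [IsManifold IP ∞ P] [CompleteSpace EP] [IsManifold IM ∞ M]

/-- An invariant vertical smooth vector field, as an element of `𝒦`. -/
def mkKernel (hP : IsPrincipalBundle IM IG IP G π) (X : ∀ u : P, TangentSpace IP u)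
    (hX : ContMDiff IP IP.tangent ∞ (fun u ↦ (X u : TangentBundle IP P)))
    (hinv : ∀ (g : G) (u : P), mfderiv IP IP (fun v : P ↦ v <• g) u (X u) = X (u <• g))
    (hvert : ∀ u, mfderiv IP IM π u (X u) = 0) : hP.atiyahKernel :=
  ⟨⟨⟨X, hX⟩, hinv⟩, hvert⟩

theorem kernel_ext (hP : IsPrincipalBundle IM IG IP G π) {k k' : hP.atiyahKernel}
    (h : ∀ u, k.1.1 u = k'.1.1 u) : k = k' :=
  Subtype.ext (Subtype.ext (ContMDiffSection.ext h))

theorem kernel_act (hP : IsPrincipalBundle IM IG IP G π) (k : hP.atiyahKernel) (g : G) (u : P) :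
    mfderiv IP IP (fun v : P ↦ v <• g) u (k.1.1 u) = k.1.1 (u <• g) :=
  k.1.2 g u

theorem kernel_proj (hP : IsPrincipalBundle IM IG IP G π) (k : hP.atiyahKernel) (u : P) :
    mfderiv IP IM π u (k.1.1 u) = 0 :=
  k.2 u

theorem kernel_eq_of_proj_eq (hP : IsPrincipalBundle IM IG IP G π) {k k' : hP.atiyahKernel}
    {u v : P} (huv : π u = π v) (h : k.1.1 u = k'.1.1 u) : k.1.1 v = k'.1.1 v := by
  obtain ⟨g, rfl⟩ := hP.exists_act_eq huv
  rw [← hP.kernel_act, ← hP.kernel_act, h]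

variable [LieGroup IG ∞ G]

theorem exists_fundamentalMap_eq (hP : IsPrincipalBundle IM IG IP G π) (u : P)
    (k : hP.atiyahKernel) : ∃ h, fundamentalMap (G := G) IG IP u h = k.1.1 u := by
  obtain ⟨U, q, s, hu, h⟩ := hP.exists_localTriv (π u)
  exact ⟨_, hP.fundamentalMap_mfderiv h hu (hP.kernel_proj k u)⟩

/-- The element `h` of the Lie algebra for which `k u` is the fundamental vector of `h`. -/
def coord (hP : IsPrincipalBundle IM IG IP G π) (u : P) :
    hP.atiyahKernel →ₗ[ℝ] GroupLieAlgebra IG G where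
  toFun k := (hP.exists_fundamentalMap_eq u k).choose
  map_add' k k' := hP.fundamentalMap_injective u (by
    rw [map_add, (hP.exists_fundamentalMap_eq u _).choose_spec,
      (hP.exists_fundamentalMap_eq u _).choose_spec, (hP.exists_fundamentalMap_eq u _).choose_spec]
    rfl)
  map_smul' c k := hP.fundamentalMap_injective u (by
    rw [map_smul, (hP.exists_fundamentalMap_eq u _).choose_spec,
      (hP.exists_fundamentalMap_eq u _).choose_spec]
    rfl)

theorem fundamentalMap_coord (hP : IsPrincipalBundle IM IG IP G π) (u : P) (k : hP.atiyahKernel) :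
    fundamentalMap (G := G) IG IP u (hP.coord u k) = k.1.1 u :=
  (hP.exists_fundamentalMap_eq u k).choose_spec

theorem coord_eq_iff (hP : IsPrincipalBundle IM IG IP G π) {u : P} {k : hP.atiyahKernel}
    {h : GroupLieAlgebra IG G} :
    hP.coord u k = h ↔ k.1.1 u = fundamentalMap (G := G) IG IP u h := by
  rw [← hP.fundamentalMap_coord u k, (hP.fundamentalMap_injective u).eq_iff]

theorem coord_eq_coord_iff (hP : IsPrincipalBundle IM IG IP G π) {u : P} {k k' : hP.atiyahKernel} :
    hP.coord u k = hP.coord u k' ↔ k.1.1 u = k'.1.1 u := by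
  rw [hP.coord_eq_iff, hP.fundamentalMap_coord]

/-- By invariance, vanishing at one point of a fibre means vanishing on the whole fibre. This makes
coordinates at two points of a fibre comparable without the adjoint representation. -/
theorem ker_coord_eq (hP : IsPrincipalBundle IM IG IP G π) {u v : P} (huv : π u = π v) :
    LinearMap.ker (hP.coord u) = LinearMap.ker (hP.coord v) := by
  ext k
  have h0 : ∀ w, k ∈ LinearMap.ker (hP.coord w) ↔
      k.1.1 w = (0 : hP.atiyahKernel).1.1 w := fun w ↦ by
    rw [LinearMap.mem_ker, ← map_zero (hP.coord w), hP.coord_eq_coord_iff]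
  rw [h0, h0]
  exact ⟨hP.kernel_eq_of_proj_eq huv, hP.kernel_eq_of_proj_eq huv.symm⟩

/-- An element of `𝒦` is related to a right invariant vector field on `G` by an orbit map. -/
theorem kernel_orbit (hP : IsPrincipalBundle IM IG IP G π) (u : P) (k : hP.atiyahKernel) (g : G) :
    k.1.1 (u <• g) = mfderiv IG IP (fun a : G ↦ u <• a) g (invPullback (-hP.coord u k) g) := by
  have h1 : (fun v : P ↦ v <• g) ∘ (fun a : G ↦ u <• a) =
      (fun a : G ↦ u <• a) ∘ (fun a : G ↦ a * g) := by
    funext a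
    simp [mul_smul]
  have h2 : mfderiv IG IP ((fun v : P ↦ v <• g) ∘ (fun a : G ↦ u <• a)) 1 (hP.coord u k) =
      mfderiv IP IP (fun v : P ↦ v <• g) u
        (mfderiv IG IP (fun a : G ↦ u <• a) 1 (hP.coord u k)) :=
    mfderiv_comp_apply_of_eq (1 : G) (hP.mdifferentiableAt_right g u)
      (hP.mdifferentiableAt_orbit u 1) (by simp) _
  have h3 : mfderiv IG IP ((fun a : G ↦ u <• a) ∘ (fun a : G ↦ a * g)) 1 (hP.coord u k) =
      mfderiv IG IP (fun a : G ↦ u <• a) g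
        (mfderiv IG IG (fun a : G ↦ a * g) 1 (hP.coord u k)) :=
    mfderiv_comp_apply_of_eq (1 : G) (hP.mdifferentiableAt_orbit u g)
      (mdifferentiableAt_mul_right g 1) (one_mul g) _
  -- The argument carries a minus sign because `invPullback h` has the value `-h` at `1`.
  have h4 := invPullback_apply (-hP.coord u k) g
  rw [neg_neg] at h4
  rw [← hP.kernel_act, ← hP.fundamentalMap_coord u k]
  refine Eq.trans h2.symm ?_
  rw [h1]
  refine Eq.trans h3 ?_
  exact congrArg (mfderiv IG IP (fun a : G ↦ u <• a) g : EG →L[ℝ] EP) h4.symm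

variable [CompleteSpace EG] [FiniteDimensional ℝ EP] [T2Space P]

/-- Along the orbit of `u`, elements of `𝒦` are related to right invariant fields on `G`, whose
bracket is opposite to that of left invariant ones. -/
theorem coord_lie (hP : IsPrincipalBundle IM IG IP G π) (u : P) (k k' : hP.atiyahKernel) :
    hP.coord u ⁅k, k'⁆ = -⁅hP.coord u k, hP.coord u k'⁆ := by
  rw [hP.coord_eq_iff]
  have hs : ∀ k : hP.atiyahKernel,
      ContMDiff IP IP.tangent 2 (fun y ↦ (k.1.1 y : TangentBundle IP P)) := fun k ↦
    k.1.1.contMDiff.of_le (by norm_cast)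
  have h1 := mlieBracket_of_related (hP.contMDiff_orbit u)
    (contMDiff_invPullback (-hP.coord u k)) (contMDiff_invPullback (-hP.coord u k'))
    (hs k) (hs k') (hP.kernel_orbit u k) (hP.kernel_orbit u k') (1 : G)
  have h2 := mlieBracket_invPullback (-hP.coord u k) (-hP.coord u k')
  rw [lie_neg, neg_lie, neg_neg] at h2
  have h3 : ∀ v : P, v = u → (mlieBracket IP k.1.1 k'.1.1 v : EP) =
      (mlieBracket IP k.1.1 k'.1.1 u : EP) := by
    rintro v rfl
    rfl
  refine Eq.trans (h3 (u <• (1 : G)) (by simp)).symm (h1.trans ?_)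
  exact congrArg (mfderiv IG IP (fun a : G ↦ u <• a) 1 : EG →L[ℝ] EP) h2

/-- The evaluation at `u` as a morphism of Lie algebras. The sign is due to the bracket on the Lie
algebra of `G` being that of left invariant vector fields. -/
def evLie (hP : IsPrincipalBundle IM IG IP G π) (u : P) :
    hP.atiyahKernel →ₗ⁅ℝ⁆ GroupLieAlgebra IG G :=
  { -hP.coord u with
    map_lie' := fun {k k'} ↦ by
      change -hP.coord u ⁅k, k'⁆ = ⁅-hP.coord u k, -hP.coord u k'⁆
      rw [hP.coord_lie, lie_neg, neg_lie] }

theorem evLie_apply (hP : IsPrincipalBundle IM IG IP G π) (u : P) (k : hP.atiyahKernel) :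
    hP.evLie u k = -hP.coord u k := rfl

/-- The sign in `evLie` is harmless, as ideals are closed under negation. -/
theorem comap_evLie (hP : IsPrincipalBundle IM IG IP G π) (u : P)
    (g₀ : LieIdeal ℝ (GroupLieAlgebra IG G)) :
    (LieIdeal.comap (hP.evLie u) g₀).toSubmodule = hP.kernelIdeal u g₀ := by
  ext k
  change -hP.coord u k ∈ g₀ ↔ ∃ h ∈ g₀, fundamentalMap (G := G) IG IP u h = k.1.1 u
  rw [neg_mem_iff]
  constructor
  · exact fun hk ↦ ⟨_, hk, hP.fundamentalMap_coord u k⟩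
  · rintro ⟨h, hh, hk⟩
    rwa [hP.coord_eq_iff.mpr hk.symm]

end IsPrincipalBundle

/-! ### The kernel as an algebra of sections -/

namespace IsPrincipalBundle

variable [IsManifold IP ∞ P] [CompleteSpace EP] [IsManifold IM ∞ M]

theorem exists_kernel_smul (hP : IsPrincipalBundle IM IG IP G π) (f : C^∞⟮IM, M; 𝓘(ℝ, ℝ), ℝ⟯)
    (k : hP.atiyahKernel) : ∃ k' : hP.atiyahKernel, ∀ u, k'.1.1 u = f (π u) • k.1.1 u := by
  refine ⟨hP.mkKernel (fun u ↦ f (π u) • k.1.1 u) ?_ ?_ ?_, fun u ↦ rfl⟩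
  · exact ContMDiff.smul_section (f.contMDiff.comp hP.contMDiff_proj) k.1.1.contMDiff
  · intro g u
    rw [map_smul, hP.kernel_act, hP.proj_act]
  · intro u
    rw [map_smul, hP.kernel_proj, smul_zero]

theorem exists_kernel_glue (hP : IsPrincipalBundle IM IG IP G π) (κ : M → hP.atiyahKernel)
    (hκ : ∀ m, ∀ᶠ x in 𝓝 m, ∀ u, π u = x → (κ x).1.1 u = (κ m).1.1 u) :
    ∃ k : hP.atiyahKernel, ∀ u, k.1.1 u = (κ (π u)).1.1 u := by
  refine ⟨hP.mkKernel (fun u ↦ (κ (π u)).1.1 u) ?_ ?_ ?_, fun u ↦ rfl⟩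
  · intro u₀
    refine ((κ (π u₀)).1.1.contMDiff u₀).congr_of_eventuallyEq ?_
    filter_upwards [hP.contMDiff_proj.continuous.continuousAt.eventually (hκ (π u₀))] with u hu
    rw [hu u rfl]
  · intro g u
    rw [hP.kernel_act, hP.proj_act]
  · intro u
    exact hP.kernel_proj _ u

variable [LieGroup IG ∞ G]

/-- In a trivialization, left translations of the group component commute with the right action and
preserve the fibres. Their infinitesimal generator is thus invariant and vertical, and remains so
after multiplication by a bump function on the base. -/
theorem exists_kernel_apply_eq [FiniteDimensional ℝ EM] [T2Space M]
    (hP : IsPrincipalBundle IM IG IP G π) (u : P) (h : GroupLieAlgebra IG G) :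
    ∃ k : hP.atiyahKernel, k.1.1 u = fundamentalMap (G := G) IG IP u h := by
  obtain ⟨U, q, s, hu, ht⟩ := hP.exists_localTriv (π u)
  obtain ⟨f, -, hf⟩ := (SmoothBumpFunction.nhds_basis_tsupport (I := IM) (π u)).mem_iff.mp
    (ht.isOpen.mem_nhds hu)
  have hO : IsOpen (π ⁻¹' U) := ht.isOpen.preimage hP.contMDiff_proj.continuous
  -- Conjugation by `q u` is chosen so that `Ψ (u, t) = u <• t`; the generator at `u` is then
  -- exactly the fundamental vector of `h`.
  let Ψ : P × G → P := fun p ↦ s (π p.1, q u * p.2 * (q u)⁻¹ * q p.1)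
  have hΨ : ∀ p ∈ (π ⁻¹' U) ×ˢ (univ : Set G), ContMDiffAt (IP.prod IG) IP ∞ Ψ p := by
    rintro ⟨v, t⟩ ⟨hv, -⟩
    have h1 : ContMDiffAt (IP.prod IG) IM ∞ (fun p : P × G ↦ π p.1) (v, t) :=
      (hP.contMDiff_proj v).comp (v, t) contMDiffAt_fst
    have h2 : ContMDiffAt (IP.prod IG) IG ∞ (fun p : P × G ↦ q p.1) (v, t) :=
      (ht.contMDiffAt_q v hv).comp (v, t) contMDiffAt_fst
    have h3 : ContMDiffAt (IP.prod IG) IG ∞ (fun p : P × G ↦ q u * p.2 * (q u)⁻¹ * q p.1)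
        (v, t) := ((contMDiffAt_const.mul contMDiffAt_snd).mul contMDiffAt_const).mul h2
    exact (ht.contMDiffAt_s (π v) hv _).comp (v, t) (h1.prodMk h3)
  have hΨ1 : ∀ v, π v ∈ U → Ψ (v, 1) = v := by
    intro v hv
    simp only [Ψ, mul_one, mul_inv_cancel, one_mul]
    exact ht.s_proj_q v hv
  have hΨd : ∀ v, π v ∈ U → MDifferentiableAt IG IP (fun t : G ↦ Ψ (v, t)) 1 := by
    intro v hv
    exact ((hΨ (v, 1) ⟨hv, trivial⟩).comp (1 : G)
      (contMDiffAt_const.prodMk contMDiffAt_id)).mdifferentiableAt (by simp)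
  let w : ∀ v : P, TangentSpace IP v := fun v ↦
    (mfderiv IG IP (fun t : G ↦ Ψ (v, t)) 1 h : EP)
  have hw : ContMDiffOn IP IP.tangent ∞ (fun v ↦ (w v : TangentBundle IP P)) (π ⁻¹' U) := by
    intro v hv
    -- The field `w` is the tangent map of `Ψ` applied to the zero vector at `v` and `h` at `1`,
    -- hence smooth.
    have s1 : ContMDiff IP (IP.tangent.prod IG.tangent) ∞
        (fun v : P ↦ ((⟨v, 0⟩, ⟨1, h⟩) : TangentBundle IP P × TangentBundle IG G)) :=
      (Bundle.contMDiff_zeroSection ℝ (TangentSpace IP : P → Type _)).prodMk contMDiff_const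
    have s2 : ContMDiff (IP.tangent.prod IG.tangent) (IP.prod IG).tangent ∞
        (equivTangentBundleProd IP P IG G).symm := contMDiff_equivTangentBundleProd_symm
    have s3 := contMDiffAt_tangentMap (hO.prod isOpen_univ) hΨ
      (p := (equivTangentBundleProd IP P IG G).symm (⟨v, 0⟩, ⟨1, h⟩)) ⟨hv, trivial⟩
    have s4 := s3.comp v ((s2.comp s1) v)
    refine (s4.congr_of_eventuallyEq ?_).contMDiffWithinAt
    filter_upwards [hO.mem_nhds hv] with v' hv'
    have hd : MDifferentiableAt (IP.prod IG) IP Ψ (v', 1) :=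
      (hΨ (v', 1) ⟨hv', trivial⟩).mdifferentiableAt (by simp)
    let p : EP × EG := (0, h)
    have e1 := mfderiv_prod_eq_add_apply hd (v := p)
    have e2 : (mfderiv (IP.prod IG) IP Ψ (v', 1) : EP × EG →L[ℝ] EP) p = w v' := by
      refine Eq.trans e1 ?_
      let b : EP := w v'
      have e3 : (mfderiv IP IP (fun z : P ↦ Ψ (z, (1 : G))) v' : EP →L[ℝ] EP) p.1 = 0 :=
        map_zero (mfderiv IP IP (fun z : P ↦ Ψ (z, (1 : G))) v' : EP →L[ℝ] EP)
      exact (congrArg (fun a : EP ↦ a + b) e3).trans (zero_add b)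
    have e4 : ∀ (a b : P) (x y : EP), a = b → x = y →
        (⟨a, x⟩ : TangentBundle IP P) = ⟨b, y⟩ := by
      rintro a _ x _ rfl rfl
      rfl
    exact e4 _ _ _ _ (hΨ1 v' hv').symm e2.symm
  refine ⟨hP.mkKernel ((fun v ↦ f (π v)) • w) ?_ ?_ ?_, ?_⟩
  · refine ContMDiffOn.smul_section_of_tsupport (f.contMDiff.comp hP.contMDiff_proj).contMDiffOn
      hO ?_ hw
    exact (tsupport_comp_subset_preimage f hP.contMDiff_proj.continuous).trans
      (preimage_mono hf)
  · intro g v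
    have hsmul := map_smul (mfderiv IP IP (fun v : P ↦ v <• g) v) (f (π v)) (w v)
    refine Eq.trans hsmul ?_
    change f (π v) • mfderiv IP IP (fun v : P ↦ v <• g) v (w v) = f (π (v <• g)) • w (v <• g)
    rw [hP.proj_act]
    by_cases hv : π v ∈ U
    · have h1 : (fun t : G ↦ Ψ (v <• g, t)) = (fun v : P ↦ v <• g) ∘ fun t : G ↦ Ψ (v, t) := by
        funext t
        simp only [Ψ, Function.comp_apply, hP.proj_act, ht.q_act v hv, ht.s_act hv, mul_assoc]
      have h2 : mfderiv IG IP ((fun v : P ↦ v <• g) ∘ fun t : G ↦ Ψ (v, t)) 1 h =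
          mfderiv IP IP (fun v : P ↦ v <• g) v (mfderiv IG IP (fun t : G ↦ Ψ (v, t)) 1 h) :=
        mfderiv_comp_apply_of_eq (1 : G) (hP.mdifferentiableAt_right g v) (hΨd v hv) (hΨ1 v hv) h
      rw [← h1] at h2
      exact congrArg (fun a : EP ↦ f (π v) • a) h2.symm
    · have : f (π v) = 0 := image_eq_zero_of_notMem_tsupport fun hv' ↦ hv (hf hv')
      rw [this]
      exact (zero_smul ℝ _).trans (zero_smul ℝ _).symm
  · intro v
    have hsmul := map_smul (mfderiv IP IM π v) (f (π v)) (w v)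
    refine Eq.trans hsmul ?_
    by_cases hv : π v ∈ U
    · have h1 : π ∘ (fun t : G ↦ Ψ (v, t)) = fun _ ↦ π v := by
        funext t
        exact ht.proj_s _ hv _
      have h2 : mfderiv IG IM (π ∘ fun t : G ↦ Ψ (v, t)) 1 h =
          mfderiv IP IM π v (mfderiv IG IP (fun t : G ↦ Ψ (v, t)) 1 h) :=
        mfderiv_comp_apply_of_eq (1 : G) (hP.mdifferentiableAt_proj v) (hΨd v hv) (hΨ1 v hv) h
      rw [h1, mfderiv_const] at h2
      have h3 : mfderiv IP IM π v (w v) = 0 := h2.symm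
      rw [h3, smul_zero]
    · have : f (π v) = 0 := image_eq_zero_of_notMem_tsupport fun hv' ↦ hv (hf hv')
      rw [this, zero_smul]
  · have h1 : (fun t : G ↦ Ψ (u, t)) = fun g : G ↦ u <• g := by
      funext t
      simp only [Ψ, inv_mul_cancel_right]
      rw [← ht.s_act hu, ht.s_proj_q u hu]
    change f (π u) • w u = _
    rw [f.eq_one, one_smul]
    exact congrArg (fun φ : G → P ↦ (mfderiv IG IP φ 1 : EG →L[ℝ] EP) h) h1

theorem coord_surjective [FiniteDimensional ℝ EM] [T2Space M]
    (hP : IsPrincipalBundle IM IG IP G π) (u : P) : Function.Surjective (hP.coord u) := fun h ↦ by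
  obtain ⟨k, hk⟩ := hP.exists_kernel_apply_eq u h
  exact ⟨k, hP.coord_eq_iff.mpr hk⟩

/-- Along the local section `y ↦ s (y, 1)` the function `q` is constantly `1`, so the coordinate of
`k` is its image under the derivative of `q`, a smooth family of vectors in the single tangent space
at `1`. -/
theorem contMDiffAt_coord (hP : IsPrincipalBundle IM IG IP G π) {U : Set M} {q : P → G}
    {s : M × G → P} (h : IsLocalTriv IM IG IP π U q s) (k : hP.atiyahKernel) {x : M} (hx : x ∈ U) :
    ContMDiffAt IM 𝓘(ℝ, EG) ∞ (fun y ↦ (id (hP.coord (s (y, 1)) k) : EG)) x := by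
  have hO : IsOpen (π ⁻¹' U) := h.isOpen.preimage hP.contMDiff_proj.continuous
  have h1 : ContMDiffAt IM IP ∞ (fun y ↦ s (y, (1 : G))) x :=
    (h.contMDiffAt_s x hx 1).comp x (contMDiffAt_id.prodMk contMDiffAt_const)
  have hsx : s (x, 1) ∈ π ⁻¹' U := by rwa [mem_preimage, h.proj_s x hx]
  have h2 := contMDiffAt_tangentMap hO h.contMDiffAt_q
    (p := (⟨s (x, 1), k.1.1 (s (x, 1))⟩ : TangentBundle IP P)) hsx
  have h3 := h2.comp x ((k.1.1.contMDiff (s (x, 1))).comp x h1)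
  refine contMDiffAt_of_tangentBundle (I := IG) (b := (1 : G))
    (h3.congr_of_eventuallyEq ?_)
  filter_upwards [h.isOpen.mem_nhds hx] with y hy
  have e4 : ∀ (a b : G) (x y : EG), a = b → x = y →
      (⟨a, x⟩ : TangentBundle IG G) = ⟨b, y⟩ := by
    rintro a _ x _ rfl rfl
    rfl
  refine e4 _ _ _ _ (h.q_s y hy 1).symm ?_
  have hsy : π (s (y, 1)) ∈ U := by rwa [h.proj_s y hy]
  have h5 : (fun v ↦ (q (s (y, 1)))⁻¹ * q v) = q := by
    funext v
    rw [h.q_s y hy, inv_one, one_mul]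
  have h6 := hP.fundamentalMap_mfderiv h hsy (hP.kernel_proj k _)
  refine hP.coord_eq_iff.mpr (h6.symm.trans ?_)
  rw [h5]
  rfl

variable [CompleteSpace EG] [FiniteDimensional ℝ EP] [T2Space P]

theorem isSectionAlgebra [FiniteDimensional ℝ EM] [T2Space M]
    (hP : IsPrincipalBundle IM IG IP G π) {σ : M → P} (hσ : ∀ m, π (σ m) = m) :
    IsSectionAlgebra IM EG (fun m ↦ hP.evLie (σ m)) where
  surjective m h := by
    obtain ⟨k, hk⟩ := hP.coord_surjective (σ m) (-h)
    exact ⟨k, by rw [hP.evLie_apply, hk, neg_neg]⟩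
  eq_zero k hk := by
    refine hP.kernel_ext fun u ↦ hP.kernel_eq_of_proj_eq (hσ (π u)) ?_
    rw [← hP.coord_eq_coord_iff, map_zero]
    exact neg_eq_zero.mp (hk (π u))
  exists_smul f k := by
    obtain ⟨k', hk'⟩ := hP.exists_kernel_smul f k
    refine ⟨k', fun x ↦ ?_⟩
    rw [hP.evLie_apply, hP.evLie_apply, smul_neg, ← map_smul]
    refine congrArg Neg.neg (hP.coord_eq_coord_iff.mpr ?_)
    rw [hk', hσ]
    rfl
  exists_glue v hv := by
    choose κ hκ using hv
    obtain ⟨k, hk⟩ := hP.exists_kernel_glue κ fun m ↦ by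
      filter_upwards [hκ m] with x hx u hu
      refine hP.kernel_eq_of_proj_eq ((hσ x).trans hu.symm) ?_
      rw [← hP.coord_eq_coord_iff, ← neg_inj]
      exact (hκ x).self_of_nhds.trans hx.symm
    refine ⟨k, fun x ↦ ?_⟩
    rw [← (hκ x).self_of_nhds, hP.evLie_apply, hP.evLie_apply, neg_inj, hP.coord_eq_coord_iff, hk,
      hσ]
  exists_coord m := by
    obtain ⟨U, q, s, hm, h⟩ := hP.exists_localTriv m
    -- The coordinates at the arbitrary point `σ y` and at `s (y, 1)` are surjections from `𝒦` with
    -- the same kernel, so a linear isomorphism carries one to the other. It absorbs the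
    -- discontinuity of `σ`.
    have hφ : ∀ y, ∃ φ : GroupLieAlgebra IG G ≃ₗ[ℝ] EG, y ∈ U → ∀ k : hP.atiyahKernel,
        φ (hP.evLie (σ y) k) = -(id (hP.coord (s (y, 1)) k) : EG) := by
      intro y
      by_cases hy : y ∈ U
      · have hker := hP.ker_coord_eq (u := σ y) (v := s (y, 1)) (by rw [hσ, h.proj_s y hy])
        let e := (LinearMap.quotKerEquivOfSurjective _ (hP.coord_surjective (σ y))).symm ≪≫ₗ
          Submodule.quotEquivOfEq _ _ hker ≪≫ₗ
          LinearMap.quotKerEquivOfSurjective _ (hP.coord_surjective (s (y, 1)))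
        have he : ∀ k, e (hP.coord (σ y) k) = hP.coord (s (y, 1)) k := by
          intro k
          have h1 : (LinearMap.quotKerEquivOfSurjective _ (hP.coord_surjective (σ y))).symm
              (hP.coord (σ y) k) = Submodule.Quotient.mk k := by
            rw [LinearEquiv.symm_apply_eq]
            rfl
          simp only [e, LinearEquiv.trans_apply, h1]
          rfl
        refine ⟨e, fun _ k ↦ ?_⟩
        rw [hP.evLie_apply]
        refine (map_neg e _).trans ?_
        rw [he]
        rfl
      · exact ⟨LinearEquiv.refl ℝ EG, fun hy' ↦ absurd hy' hy⟩
    choose φ hφ using hφ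
    refine ⟨U, h.isOpen, hm, φ, fun k x hx ↦ ?_⟩
    refine (hP.contMDiffAt_coord h k hx).neg.congr_of_eventuallyEq ?_
    filter_upwards [h.isOpen.mem_nhds hx] with y hy
    exact hφ y hy k

end IsPrincipalBundle

end

end Atiyah

/-- Let `P → M` be a smooth principal bundle whose structure group `G` is semisimple, i.e. the Lie
algebra `𝔤` of `G` has trivial radical. The points `σ m` of `P` over `m` are an arbitrary choice of
identifications of the fibres of `K = P ×_G 𝔤` with `𝔤`. A subspace `S` of the kernel `𝒦` of the
Atiyah sequence is a maximal finite-codimensional Lie ideal of `𝒦` if and only if it is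
`𝒦(m, 𝔤₀)` for some `m` in `M` and some maximal Lie ideal `𝔤₀` of `𝔤`. -/
theorem mainTheorem6
    {EM : Type*} [NormedAddCommGroup EM] [NormedSpace ℝ EM] [FiniteDimensional ℝ EM]
    {HM : Type*} [TopologicalSpace HM] (IM : ModelWithCorners ℝ EM HM) [IM.Boundaryless]
    {EG : Type*} [NormedAddCommGroup EG] [NormedSpace ℝ EG] [FiniteDimensional ℝ EG]
    {HG : Type*} [TopologicalSpace HG] (IG : ModelWithCorners ℝ EG HG) [IG.Boundaryless]
    {EP : Type*} [NormedAddCommGroup EP] [NormedSpace ℝ EP] [FiniteDimensional ℝ EP]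
    {HP : Type*} [TopologicalSpace HP] (IP : ModelWithCorners ℝ EP HP) [IP.Boundaryless]
    {M : Type*} [TopologicalSpace M] [T2Space M] [SecondCountableTopology M]
    [ChartedSpace HM M] [IsManifold IM ∞ M]
    {G : Type*} [TopologicalSpace G] [T2Space G] [SecondCountableTopology G]
    [ChartedSpace HG G] [Group G] [LieGroup IG ∞ G]
    {P : Type*} [TopologicalSpace P] [T2Space P] [SecondCountableTopology P]
    [ChartedSpace HP P] [IsManifold IP ∞ P] [MulAction Gᵐᵒᵖ P]
    (π : P → M) (hP : Atiyah.IsPrincipalBundle IM IG IP G π)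
    [LieAlgebra.HasTrivialRadical ℝ (GroupLieAlgebra IG G)]
    (σ : M → P) (hσ : ∀ m, π (σ m) = m)
    (S : Submodule ℝ hP.atiyahKernel) :
    (∃ J : LieIdeal ℝ hP.atiyahKernel,
        Atiyah.IsMaximalFiniteCodimensional J ∧ J.toSubmodule = S) ↔
      ∃ (m : M) (g₀ : LieIdeal ℝ (GroupLieAlgebra IG G)),
        IsCoatom g₀ ∧ S = hP.kernelIdeal (σ m) g₀ := by
  have : FiniteDimensional ℝ (GroupLieAlgebra IG G) := inferInstanceAs (FiniteDimensional ℝ EG)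
  have : LocallyCompactSpace M := Manifold.locallyCompact_of_finiteDimensional IM
  have key := (hP.isSectionAlgebra hσ).isMaximalFiniteCodimensional_iff
  constructor
  · rintro ⟨J, hJ, rfl⟩
    obtain ⟨m, g₀, hg, rfl⟩ := (key J).mp hJ
    exact ⟨m, g₀, hg, hP.comap_evLie (σ m) g₀⟩
  · rintro ⟨m, g₀, hg, rfl⟩
    exact ⟨_, (key _).mpr ⟨m, g₀, hg, rfl⟩, hP.comap_evLie (σ m) g₀⟩
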